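/- **Setting.** A public transit network has finitely many stops, trips and lines. A trip $T$ is a sequence of stop events $T[1],\dots,T[|T|]$ with stops $p(T[i])$, arrival times $\tau_{\mathrm{arr}}(T[i])$ and departure times $\tau_{\mathrm{dep}}(T[i])$; each stop may have a minimum change time $b\ge 0$ (possibly $0$) that is already subtracted from the departure times, so that $\tau_{\mathrm{arr}}(T[i])\le\tau_{\mathrm{dep}}(T[i])+b(p(T[i]))\le\tau_{\mathrm{arr}}(T[i+1])$. All trips of a line visit the same stops and are strictly ordered by $\prec$ ($T\prec T'$ iff $T$ arrives and departs earlier than $T'$ at every index). The footpaths are reflexive (with walking time $0$), transitively closed, and satisfy the triangle inequality; $\omega(p,q)$ is the walking time, and $\omega(p,q)=\infty$ if there is no footpath from $p$ to $q$. A transfer $(T_a[j],T_b[i])$ is possible if $\tau_{\mathrm{arr}}(T_a[j])+\omega(p(T_a[j]),p(T_b[i]))\le\tau_{\mathrm{dep}}(T_b[i])$. The Trip-Based Routing (TB) preprocessing computes a transfer set $\mathfrak T$. It first generates the possible transfers $(T_a[j],T_b[i])$ with $j>1$, $i<|T_b|$, not ($T_a\preceq T_b$ and $j\le i$), for which $T_b$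 is the earliest trip of its line that can be entered at index $i$ (or, in the alternative scheme, for which there is no other possible transfer $(T_a[j'],T_c[i'])$ with $j'\ge j$, $i'\le i$, $T_c\preceq T_b$). Then it removes transfers one by one. The U-turn rule removes $(T_a[j],T_b[i])\in\mathfrak T$ if $p(T_a[j-1])=p(T_b[i+1])$ and $(T_a[j-1],T_b[i+1])\in\mathfrak T$. The latest-exit rule removes $(T_a[j],T_b[i])\in\mathfrak T$ if each stop $p(T_b[l])$, $l>i$, can be reached at time $\tau_{\mathrm{arr}}(T_b[l])$ or earlier by exiting $T_a$ at an index $j'>j$, using at most one further trip, entered by a transfer in $\mathfrak T$, and a final footpath. The rules may be applied in any order. A TB query $(p_s,p_t,\tau_{\mathrm{dep}})$ runs in rounds over FIFO queues of trip segments, examining footpaths, lines and transfers in a fixed order, with reached-index pruning and target pruning, and with earliest known arrival time at $p_t$ initially $\infty$. It returns the journeys of the final Pareto front for (arrival time, number of trips), obtained by following parent pointers. A nested bipartition with $K\ge1$ levels of the stops, where stops joined by a footpath are contracted to one vertex, consists of partitions $\mathcal C^0,\dots,\mathcal C^K$ into cells, $\mathcal C^\ell$ having $2^{K-\ell}$ (possibly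 empty) cells, such that each cell on level $\ell\ge1$ is the union of two cells on level $\ell-1$. For stops $p,q$, $\mathrm{lcl}(p,q)$ is the lowest level on which they are in the same cell. An event $T[i]$ is an incoming border event of a cell $C$ if $p(T[i])\notin C$ and $p(T[i+1])\in C$, and an outgoing border event if $p(T[i])\in C$ and $p(T[i+1])\notin C$. The T-REX customization starts with $\mathrm{rank}(\mathfrak t)=0$ for all $\mathfrak t\in\mathfrak T$. For $\ell=0,\dots,K-1$, each cell $C\in\mathcal C^\ell$ and each incoming border event $\varepsilon$ of $C$, it runs an Event-TB search from $\varepsilon$: TB without target pruning, whose first queue holds only the trip segment starting at $\varepsilon$, which discards transfers of rank less than $\ell$ and cuts each trip segment off after the first outgoing border event of $C$ on it (the event at which the trip is entered included). For each outgoing border event that is reached, all transfers of the journey found for it get rank $\ell+1$. **Theorem.** Let $J$ be a journey that TB returns for a query $(p_s,p_t,\tau_{\mathrm{dep}})$ and that arrives earlier than the direct footpath from $p_s$ to $p_t$, if there is one: $\tau_{\mathrm{arr}}(J)<\tau_{\mathrm{dep}}+\omega(p_s,p_t)$. Then, after the T-REX customization, every transfer $\mathfrak t$ of $J$ passes the LCL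 test $$\mathrm{rank}(\mathfrak t)\ \ge\ \min\{\mathrm{lcl}(p,p_s),\ \mathrm{lcl}(p,p_t)\},$$ where $p$ is the stop from which $\mathfrak t$ starts; hence the pruning of the T-REX query, which discards exactly the transfers that fail this test, discards no transfer of $J$. -/

import Mathlib

namespace TREX

/-! ### Public transit networks -/

/-- A public transit network. Lines carry the common stop sequence of their trips; the events of a
trip `T` are `T[1], ..., T[k]`, where `k` is the length of its line (values of `lineStop`, `arr`,
`dep` at other indices are never used). A footpath from `p` to `q` exists iff `foot p q`, and
then takes time `walk p q`. Departure times may have the minimum change time (`buffer`) of the stop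
already subtracted from them, so `dep T i + buffer` is the time at which the vehicle really leaves;
`buffer = 0` is the plain timetable, in which `arr T i ≤ dep T i ≤ arr T (i + 1)`. -/
structure Network (Stop Trip Line : Type*) where
  foot : Stop → Stop → Prop
  walk : Stop → Stop → ℕ
  foot_refl : ∀ p, foot p p
  walk_self : ∀ p, walk p p = 0
  foot_trans : ∀ p q r, foot p q → foot q r → foot p r
  walk_triangle : ∀ p q r, foot p q → foot q r → walk p r ≤ walk p q + walk q r
  lineLen : Line → ℕ
  lineLen_pos : ∀ L, 0 < lineLen L
  lineStop : Line → ℕ → Stop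
  line : Trip → Line
  arr : Trip → ℕ → ℤ
  dep : Trip → ℕ → ℤ
  buffer : Stop → ℕ
  arr_le_dep : ∀ T i, 1 ≤ i → i ≤ lineLen (line T) →
    arr T i ≤ dep T i + buffer (lineStop (line T) i)
  dep_le_arr : ∀ T i, 1 ≤ i → i < lineLen (line T) →
    dep T i + buffer (lineStop (line T) i) ≤ arr T (i + 1)
  line_total : ∀ T T', line T = line T' → T = T' ∨
    (∀ i, 1 ≤ i → i ≤ lineLen (line T) → arr T i < arr T' i ∧ dep T i < dep T' i) ∨
    (∀ i, 1 ≤ i → i ≤ lineLen (line T) → arr T' i < arr T i ∧ dep T' i < dep T i)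

/-- `(T, i)` stands for the stop event `T[i]`. -/
abbrev StopEvent (Trip : Type*) := Trip × ℕ

/-- `((Ta, j), (Tb, i))` stands for the transfer from `Ta[j]` to `Tb[i]`. -/
abbrev Transfer (Trip : Type*) := StopEvent Trip × StopEvent Trip

/-- The trip segment `trip[entry, exit]` of a journey. -/
structure Leg (Trip : Type*) where
  trip : Trip
  entry : ℕ
  exit : ℕ

/-- The transfers between consecutive trip segments of a journey. -/
def journeyTransfers {Trip : Type*} : List (Leg Trip) → List (Transfer Trip)
  | a :: b :: l => ((a.trip, a.exit), (b.trip, b.entry)) :: journeyTransfers (b :: l)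
  | _ => []

namespace Network

variable {Stop Trip Line : Type*} (N : Network Stop Trip Line)

/-- The number of stop events of a trip. -/
def len (T : Trip) : ℕ := N.lineLen (N.line T)

/-- The stop visited by a stop event. -/
def stopOf (e : StopEvent Trip) : Stop := N.lineStop (N.line e.1) e.2

/-- `T ≺ T'`: the two trips belong to the same line and `T` is earlier everywhere. -/
def Precedes (T T' : Trip) : Prop :=
  N.line T = N.line T' ∧
    ∀ i, 1 ≤ i → i ≤ N.len T → N.arr T i < N.arr T' i ∧ N.dep T i < N.dep T' i

/-- `T ≼ T'`. -/
def PrecedesEq (T T' : Trip) : Prop := N.Precedes T T' ∨ T = T'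

/-- Pairs that denote stop events of the network. -/
def IsEvent (e : StopEvent Trip) : Prop := 1 ≤ e.2 ∧ e.2 ≤ N.len e.1

/-- A transfer: there is a footpath, and it is short enough. -/
def IsTransfer (t : Transfer Trip) : Prop :=
  N.IsEvent t.1 ∧ N.IsEvent t.2 ∧ N.foot (N.stopOf t.1) (N.stopOf t.2) ∧
    N.arr t.1.1 t.1.2 + N.walk (N.stopOf t.1) (N.stopOf t.2) ≤ N.dep t.2.1 t.2.2

/-! ### Transfer precomputation -/

/-- The transfers that the generation step considers: one does not exit at the first event, one does
not enter at the last event, and staying seated is not preferable. -/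
def IsCandidate (t : Transfer Trip) : Prop :=
  N.IsTransfer t ∧ 1 < t.1.2 ∧ t.2.2 < N.len t.2.1 ∧
    ¬ (N.PrecedesEq t.1.1 t.2.1 ∧ t.1.2 ≤ t.2.2)

end Network

/-- The two schemes for generating the initial transfer set. -/
inductive GenerationScheme
  /-- For each exit event, line and entry index, the earliest reachable trip. -/
  | earliestTrip
  /-- Additionally, a later exit, an earlier entry index and an earlier trip are preferred. -/
  | undominated

namespace Network

variable {Stop Trip Line : Type*} (N : Network Stop Trip Line)

/-- The initially generated transfer set. -/
def generated : GenerationScheme → Set (Transfer Trip)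
  | .earliestTrip =>
      {t | N.IsCandidate t ∧ ∀ T', N.Precedes T' t.2.1 → ¬ N.IsTransfer (t.1, (T', t.2.2))}
  | .undominated =>
      {t | N.IsCandidate t ∧ ∀ t', N.IsTransfer t' → t'.1.1 = t.1.1 → t.1.2 ≤ t'.1.2 →
        t'.2.2 ≤ t.2.2 → N.PrecedesEq t'.2.1 t.2.1 → t' = t}

/-- Instead of exiting trip `Ta` at index `j` one can exit it at a later index, then possibly use one
transfer of `𝔗`, and be at stop `q` at time `τ` or before. -/
def LaterExitReaches (𝔗 : Set (Transfer Trip)) (Ta : Trip) (j : ℕ) (q : Stop) (τ : ℤ) : Prop :=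
  ∃ j', j < j' ∧ j' ≤ N.len Ta ∧
    ((N.foot (N.stopOf (Ta, j')) q ∧ N.arr Ta j' + N.walk (N.stopOf (Ta, j')) q ≤ τ) ∨
      ∃ Tc i' l', ((Ta, j'), (Tc, i')) ∈ 𝔗 ∧ i' < l' ∧ l' ≤ N.len Tc ∧
        N.foot (N.stopOf (Tc, l')) q ∧ N.arr Tc l' + N.walk (N.stopOf (Tc, l')) q ≤ τ)

/-- Removal of one transfer by one of the two pruning rules. -/
inductive PruneStep : Set (Transfer Trip) → Set (Transfer Trip) → Prop
  | uTurn (𝔗 : Set (Transfer Trip)) (Ta Tb : Trip) (j i : ℕ)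
      (mem : ((Ta, j + 1), (Tb, i)) ∈ 𝔗)
      (same : N.stopOf (Ta, j) = N.stopOf (Tb, i + 1))
      (mem' : ((Ta, j), (Tb, i + 1)) ∈ 𝔗) :
      PruneStep 𝔗 (𝔗 \ {((Ta, j + 1), (Tb, i))})
  | latestExit (𝔗 : Set (Transfer Trip)) (Ta Tb : Trip) (j i : ℕ)
      (mem : ((Ta, j), (Tb, i)) ∈ 𝔗)
      (dominated : ∀ l, i < l → l ≤ N.len Tb →
        N.LaterExitReaches 𝔗 Ta j (N.stopOf (Tb, l)) (N.arr Tb l)) :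
      PruneStep 𝔗 (𝔗 \ {((Ta, j), (Tb, i))})

/-- `𝔗` is a possible result of the transfer precomputation: generation by one of the two schemes,
then applications of the pruning rules. The order of these applications and the point at which they
end are left open, so the usual order (U-turns first, to exhaustion, then latest exits) is a special
case. -/
def IsPrecomputed (𝔗 : Set (Transfer Trip)) : Prop :=
  ∃ g : GenerationScheme, Relation.ReflTransGen N.PruneStep (N.generated g) 𝔗

/-- The orders in which footpaths, lines and transfers are examined (ascending IDs). -/
structure ScanOrder (𝔗 : Set (Transfer Trip)) where
  footpaths : Stop → List Stop
  footpaths_nodup : ∀ p, (footpaths p).Nodup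
  mem_footpaths : ∀ p q, q ∈ footpaths p ↔ N.foot p q
  lines : List Line
  lines_nodup : lines.Nodup
  mem_lines : ∀ L, L ∈ lines
  transfers : StopEvent Trip → List (StopEvent Trip)
  transfers_nodup : ∀ e, (transfers e).Nodup
  mem_transfers : ∀ e e', e' ∈ transfers e ↔ (e, e') ∈ 𝔗

end Network

/-! ### Queues and the enqueue operation -/

/-- A queue element: trip `trip` is entered at `entry`, and can be exited at the indices
`entry + 1, ..., last`. Instead of a parent pointer, the element stores the trip segments that lead
to it, i.e. the unpacked chain of parent pointers. -/
structure QueueElem (Trip : Type*) where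
  trip : Trip
  entry : ℕ
  last : ℕ
  parents : List (Leg Trip)

/-- The indices at which the trip of a queue element can be exited, in increasing order. -/
def QueueElem.exits {Trip : Type*} (s : QueueElem Trip) : List ℕ :=
  List.range' (s.entry + 1) (s.last - s.entry)

/-- The journey that is found for the event with index `i` of a queue element. -/
def QueueElem.journey {Trip : Type*} (s : QueueElem Trip) (i : ℕ) : List (Leg Trip) :=
  s.parents ++ [⟨s.trip, s.entry, i⟩]

/-- The reached indices together with the queue that is being filled. -/
structure Frontier (Trip : Type*) where
  reached : Trip → ℕ
  queue : List (QueueElem Trip)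

/-- A cost vector with its journey. -/
structure Label (Trip : Type*) where
  arrival : ℤ
  trips : ℕ
  journey : List (Leg Trip)

/-- Domination of cost vectors. -/
def Label.Dominates {Trip : Type*} (x y : Label Trip) : Prop :=
  x.arrival ≤ y.arrival ∧ x.trips ≤ y.trips ∧ (x.arrival < y.arrival ∨ x.trips < y.trips)

noncomputable section

namespace Network

variable {Stop Trip Line : Type*} (N : Network Stop Trip Line)

/-- Nothing is reached yet, and the queue is empty. -/
def emptyFrontier : Frontier Trip := ⟨fun T => N.len T + 1, []⟩

open Classical in
/-- Enqueue the segment of trip `T` that is entered at index `i`, unless it is already reached, and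
update the reached indices of `T` and the later trips of its line. -/
def enqueue (T : Trip) (i : ℕ) (parents : List (Leg Trip)) (f : Frontier Trip) : Frontier Trip :=
  if f.reached T ≤ i + 1 then f
  else
    { reached := fun T' => if N.PrecedesEq T T' then min (f.reached T') (i + 1) else f.reached T'
      queue := f.queue ++ [⟨T, i, f.reached T - 1, parents⟩] }

open Classical in
/-- Relax, for all elements `s` of the queue `Q` and all exit indices in `exits s`, the outgoing
transfers that are `allowed`. -/
def relax {𝔗 : Set (Transfer Trip)} (O : N.ScanOrder 𝔗) (allowed : Transfer Trip → Prop)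
    (exits : QueueElem Trip → List ℕ) (Q : List (QueueElem Trip)) (reached : Trip → ℕ) :
    Frontier Trip :=
  Q.foldl (fun f s =>
    (exits s).foldl (fun f i =>
      (O.transfers (s.trip, i)).foldl (fun f e =>
        if allowed ((s.trip, i), e) then N.enqueue e.1 e.2 (s.journey i) f else f) f) f)
    ⟨reached, []⟩

/-! ### The TB query -/

/-- `T` is the earliest trip of line `L` that can be entered at index `i` at time `τ`. -/
def IsEarliestTrip (L : Line) (i : ℕ) (τ : ℤ) (T : Trip) : Prop :=
  N.line T = L ∧ τ ≤ N.dep T i ∧ ∀ T', N.Precedes T' T → ¬ τ ≤ N.dep T' i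

open Classical in
/-- Examine index `i` of line `L` for a passenger who is at stop `q` at time `τ`. -/
def enterLine (q : Stop) (τ : ℤ) (L : Line) (i : ℕ) (f : Frontier Trip) : Frontier Trip :=
  if h : N.lineStop L i = q ∧ ∃ T, N.IsEarliestTrip L i τ T then
    N.enqueue h.2.choose i [] f
  else f

/-- The first queue of a query from stop `ps` at time `τ`. -/
def initialFrontier {𝔗 : Set (Transfer Trip)} (O : N.ScanOrder 𝔗) (ps : Stop) (τ : ℤ) :
    Frontier Trip :=
  (O.footpaths ps).foldl (fun f q =>
    O.lines.foldl (fun f L =>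
      (List.range' 1 (N.lineLen L - 1)).foldl (fun f i =>
        N.enterLine q (τ + N.walk ps q) L i f) f) f)
    N.emptyFrontier

/-- The state of a TB query at the start of a round. `tmin` is the earliest known arrival time at the
target, `front` is the tentative Pareto front. -/
structure _root_.TREX.TBState (Trip : Type*) where
  reached : Trip → ℕ
  queue : List (QueueElem Trip)
  tmin : WithTop ℤ
  front : List (Label Trip)

open Classical in
/-- The first loop of round `n` for one queue element, over a list of exit indices. -/
def scanExits (pt : Stop) (n : ℕ) (s : QueueElem Trip) :
    List ℕ → WithTop ℤ × List (Label Trip) → WithTop ℤ × List (Label Trip)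
  | [], x => x
  | i :: is, x =>
    if x.1 ≤ ((N.arr s.trip i : ℤ) : WithTop ℤ) then x
    else
      let p := N.stopOf (s.trip, i)
      let a : ℤ := N.arr s.trip i + N.walk p pt
      let y : Label Trip := ⟨a, n, s.journey i⟩
      if N.foot p pt ∧ (a : WithTop ℤ) < x.1 then
        scanExits pt n s is ((a : WithTop ℤ), x.2.filter (fun z => ¬ y.Dominates z) ++ [y])
      else scanExits pt n s is x

open Classical in
/-- Round `n` of a TB query with target `pt`: collect the improvements at the target, cut the
segments off at the first event that arrives at `tmin` or later, relax the outgoing transfers. -/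
def tbRound {𝔗 : Set (Transfer Trip)} (O : N.ScanOrder 𝔗) (pt : Stop) (n : ℕ)
    (σ : TBState Trip) : TBState Trip :=
  let x := σ.queue.foldl (fun x s => N.scanExits pt n s s.exits x) (σ.tmin, σ.front)
  let f := N.relax O (fun _ => True)
    (fun s => s.exits.takeWhile (fun i => ((N.arr s.trip i : ℤ) : WithTop ℤ) < x.1))
    σ.queue σ.reached
  ⟨f.reached, f.queue, x.1, x.2⟩

/-- The state of the TB query `(ps, pt, τ)` after `n` rounds. -/
def tbState {𝔗 : Set (Transfer Trip)} (O : N.ScanOrder 𝔗) (ps pt : Stop) (τ : ℤ) :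
    ℕ → TBState Trip
  | 0 => ⟨(N.initialFrontier O ps τ).reached, (N.initialFrontier O ps τ).queue, ⊤, []⟩
  | n + 1 => N.tbRound O pt (n + 1) (tbState O ps pt τ n)

/-- TB returns the journey of `J` for the query `(ps, pt, τ)`: when the queue has run empty, `J` is in
the Pareto front. -/
def TBReturns {𝔗 : Set (Transfer Trip)} (O : N.ScanOrder 𝔗) (ps pt : Stop) (τ : ℤ)
    (J : Label Trip) : Prop :=
  ∃ n, (N.tbState O ps pt τ n).queue = [] ∧ J ∈ (N.tbState O ps pt τ n).front

end Network

/-! ### Nested bipartitions -/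

/-- A nested bipartition of a vertex set into `K` levels. -/
structure NestedBipartition (V : Type*) (K : ℕ) where
  /-- `cell ℓ i` is the cell with ID `i < 2 ^ (K - ℓ)` on level `ℓ ≤ K`. -/
  cell : ℕ → ℕ → Set V
  cover : ∀ ℓ, ℓ ≤ K → ∀ v, ∃ i, i < 2 ^ (K - ℓ) ∧ v ∈ cell ℓ i
  disjoint : ∀ ℓ, ℓ ≤ K → ∀ i j, i < 2 ^ (K - ℓ) → j < 2 ^ (K - ℓ) → i ≠ j →
    Disjoint (cell ℓ i) (cell ℓ j)
  split : ∀ ℓ, ℓ < K → ∀ i, i < 2 ^ (K - (ℓ + 1)) →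
    cell ℓ (2 * i) ∪ cell ℓ (2 * i + 1) = cell (ℓ + 1) i

/-- The lowest common level of two vertices. -/
def NestedBipartition.lcl {V : Type*} {K : ℕ} (B : NestedBipartition V K) (u v : V) : ℕ :=
  sInf {ℓ | ℓ ≤ K ∧ ∃ i, i < 2 ^ (K - ℓ) ∧ u ∈ B.cell ℓ i ∧ v ∈ B.cell ℓ i}

namespace Network

variable {Stop Trip Line : Type*} (N : Network Stop Trip Line)

/-- The vertices of the compact layout graph: stops connected by footpaths are contracted. -/
def Vertex : Type _ := Quot N.foot

/-- The vertex that represents a stop. -/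
def vertex (p : Stop) : N.Vertex := Quot.mk _ p

/-! ### The customization -/

/-- `T[i]` is an incoming border event of the cell `C`. -/
def IsIBE (C : Set N.Vertex) (e : StopEvent Trip) : Prop :=
  1 ≤ e.2 ∧ e.2 < N.len e.1 ∧ N.vertex (N.stopOf e) ∉ C ∧ N.vertex (N.stopOf (e.1, e.2 + 1)) ∈ C

/-- `T[i]` is an outgoing border event of the cell `C`. -/
def IsOBE (C : Set N.Vertex) (e : StopEvent Trip) : Prop :=
  1 ≤ e.2 ∧ e.2 < N.len e.1 ∧ N.vertex (N.stopOf e) ∈ C ∧ N.vertex (N.stopOf (e.1, e.2 + 1)) ∉ C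

open Classical in
/-- The first outgoing border event that is encountered on the trip segment of a queue element. The
event at which the trip is entered belongs to the segment. -/
def firstOBE (C : Set N.Vertex) (s : QueueElem Trip) : Option ℕ :=
  (s.entry :: s.exits).find? (fun i => N.IsOBE C (s.trip, i))

/-- Cut a queue element off after the first outgoing border event. -/
def cutOff (C : Set N.Vertex) (s : QueueElem Trip) : QueueElem Trip :=
  match N.firstOBE C s with
  | some i => { s with last := i }
  | none => s

/-- The state of an Event-TB search at the start of a round. `found` holds the outgoing border events
that have been reached, each with the journey that was found for it. -/
structure _root_.TREX.EventState (Trip : Type*) where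
  reached : Trip → ℕ
  queue : List (QueueElem Trip)
  found : List (StopEvent Trip × List (Leg Trip))

open Classical in
/-- The first loop for one queue element: collect the reached outgoing border event. -/
def collectOBE (C : Set N.Vertex) (found : List (StopEvent Trip × List (Leg Trip)))
    (s : QueueElem Trip) : List (StopEvent Trip × List (Leg Trip)) :=
  match N.firstOBE C s with
  | some i =>
      if ∃ y ∈ found, y.1 = (s.trip, i) then found else found ++ [((s.trip, i), s.journey i)]
  | none => found

/-- The Event-TB search from the stop event `e`, restricted to the cell `C`, after a number of
rounds. Transfers whose rank is smaller than `ℓ` are discarded. -/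
def eventState {𝔗 : Set (Transfer Trip)} (O : N.ScanOrder 𝔗) (C : Set N.Vertex) (ℓ : ℕ)
    (rank : Transfer Trip → ℕ) (e : StopEvent Trip) : ℕ → EventState Trip
  | 0 =>
    let f := N.enqueue e.1 e.2 [] N.emptyFrontier
    ⟨f.reached, f.queue, []⟩
  | n + 1 =>
    let σ := eventState O C ℓ rank e n
    let f := N.relax O (fun t => ¬ rank t < ℓ) (fun s => (N.cutOff C s).exits) σ.queue σ.reached
    ⟨f.reached, f.queue, σ.queue.foldl (N.collectOBE C) σ.found⟩

/-- The transfer `t` occurs in a journey that the customization of level `ℓ` unpacks, if `rank` are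
the ranks at the start of that level. (Ranks that are set to `ℓ + 1` while level `ℓ` is processed do
not influence the other searches on level `ℓ`.) -/
def IsUnpacked {𝔗 : Set (Transfer Trip)} (O : N.ScanOrder 𝔗) {K : ℕ}
    (B : NestedBipartition N.Vertex K) (ℓ : ℕ) (rank : Transfer Trip → ℕ) (t : Transfer Trip) :
    Prop :=
  ∃ c, c < 2 ^ (K - ℓ) ∧ ∃ e, N.IsIBE (B.cell ℓ c) e ∧
    ∃ n, ∃ y ∈ (N.eventState O (B.cell ℓ c) ℓ rank e n).found, t ∈ journeyTransfers y.2

open Classical in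
/-- The ranks after the levels `0, ..., ℓ - 1` have been processed. -/
def rankAfter {𝔗 : Set (Transfer Trip)} (O : N.ScanOrder 𝔗) {K : ℕ}
    (B : NestedBipartition N.Vertex K) : ℕ → Transfer Trip → ℕ
  | 0, _ => 0
  | ℓ + 1, t => if N.IsUnpacked O B ℓ (rankAfter O B ℓ) t then ℓ + 1 else rankAfter O B ℓ t

/-- The ranks after the customization, in which the levels `0, ..., K - 1` are processed. -/
def rank {𝔗 : Set (Transfer Trip)} (O : N.ScanOrder 𝔗) {K : ℕ}
    (B : NestedBipartition N.Vertex K) : Transfer Trip → ℕ :=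
  N.rankAfter O B K

/-- The lowest common level of two stops. -/
def lcl {K : ℕ} (B : NestedBipartition N.Vertex K) (p q : Stop) : ℕ :=
  B.lcl (N.vertex p) (N.vertex q)

/-- The test that a transfer has to pass in the T-REX query from `ps` to `pt` in order to be
relaxed. -/
def PassesLCLTest {𝔗 : Set (Transfer Trip)} (O : N.ScanOrder 𝔗) {K : ℕ}
    (B : NestedBipartition N.Vertex K) (ps pt : Stop) (t : Transfer Trip) : Prop :=
  min (N.lcl B (N.stopOf t.1) ps) (N.lcl B (N.stopOf t.1) pt) ≤ N.rank O B t

end Network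

end

end TREX

/-!
Fix a journey `J` that TB returns and let `A` be its arrival time. `Reaches` and `Boards` express
that some feasible journey, not necessarily one that uses the precomputed transfers, reaches the
target by `A` with a bounded number of trips.

*The precomputed transfers lose nothing* (`IsPrecomputed.isComplete`). A feasible transfer after
which the target can be reached can be replaced by a transfer of `𝔗` from the same trip, or a trip
can be saved. The only replacement that does not stay on the current trip is the one for a U-turn
right after the entry, which skips this trip altogether; at the very start of a journey this may
leave a direct walk, and this is where the assumption on the direct footpath is used.

*TB returns the first optimal journey in scan order* (`exists_isOptimalRoute`). TB and Event-TB are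
both sequences of enqueue operations (`IsSearch`), and the elements of a queue are ordered like the
requests that produced them. `IsSearch.not_boards_of_prefix` shows, by induction on the total number
of trips, then on the number of remaining trips, then on the position in the queue, that no queue
element of TB continues to a journey that arrives by `A` with fewer trips than `J`, and that none of
the elements in front of those of `J` does so with equally many trips: TB would have found such a
journey before `J`, and `J` would not have improved the arrival time at the target. Pruning by
reached indices is harmless, since it refers to an element that is no worse and lies further in
front; pruning by the target is harmless, since the arrival times along such journeys are at
most `A`. The result is the notion `IsOptimalRoute`.

*Event-TB follows `J`* (`IsOptimalRoute.exists_mem_found`). Start an Event-TB search at an event of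
`J`. If a segment of `J` were pruned or shortened in it, or if the outgoing border event of `J` were
collected from another queue element, then an element that Event-TB enqueued before would continue
along the rest of `J`, with fewer trips or with a choice that precedes the one of `J` in the scan
order. Both contradict the optimality of `J`.

*Ranks* (`IsOptimalRoute.le_rankAfter`). A transfer of `J` whose lowest common levels with both
source and target exceed `ℓ` lies in a level-`ℓ` cell `C` that contains neither of them. So `J`
enters `C` before the transfer and leaves it afterwards, and all transfers of `J` in between lie in
`C`, hence have rank at least `ℓ` by induction on the level and are not discarded. The search for
`C` therefore unpacks the transfer and raises its rank to `ℓ + 1`.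
-/

namespace TREX

namespace Network

variable {Stop Trip Line : Type*} (N : Network Stop Trip Line)

/-! ### Timetable monotonicity and the order of the trips of a line -/

theorem arr_le_arr_succ {T : Trip} {i : ℕ} (hi : 1 ≤ i) (h : i < N.len T) :
    N.arr T i ≤ N.arr T (i + 1) :=
  (N.arr_le_dep T i hi h.le).trans (N.dep_le_arr T i hi h)

theorem arr_mono {T : Trip} {i j : ℕ} (hi : 1 ≤ i) (hij : i ≤ j) (hj : j ≤ N.len T) :
    N.arr T i ≤ N.arr T j := by
  induction j, hij using Nat.le_induction with
  | base => exact le_rfl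
  | succ j hij ih => exact (ih (by omega)).trans (N.arr_le_arr_succ (by omega) (by omega))

theorem dep_le_arr_of_lt {T : Trip} {i j : ℕ} (hi : 1 ≤ i) (hij : i < j) (hj : j ≤ N.len T) :
    N.dep T i ≤ N.arr T j := by
  have h1 := N.dep_le_arr T i hi (show i < N.len T by omega)
  have h2 := N.arr_mono (T := T) (show 1 ≤ i + 1 by omega) (show i + 1 ≤ j by omega) hj
  omega

variable {N}

theorem PrecedesEq.refl (T : Trip) : N.PrecedesEq T T := Or.inr rfl

theorem PrecedesEq.line_eq {T T' : Trip} (h : N.PrecedesEq T T') : N.line T = N.line T' := by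
  rcases h with h | rfl
  · exact h.1
  · rfl

theorem PrecedesEq.len_eq {T T' : Trip} (h : N.PrecedesEq T T') : N.len T = N.len T' := by
  rw [len, len, h.line_eq]

theorem PrecedesEq.stopOf_eq {T T' : Trip} (h : N.PrecedesEq T T') (i : ℕ) :
    N.stopOf (T, i) = N.stopOf (T', i) := by
  simp only [stopOf, h.line_eq]

theorem Precedes.trans {T T' T'' : Trip} (h : N.Precedes T T') (h' : N.Precedes T' T'') :
    N.Precedes T T'' := by
  refine ⟨h.1.trans h'.1, fun i hi hl => ?_⟩
  have h1 := h.2 i hi hl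
  have h2 := h'.2 i hi (by rwa [len, ← h.1])
  omega

theorem PrecedesEq.trans {T T' T'' : Trip} (h : N.PrecedesEq T T') (h' : N.PrecedesEq T' T'') :
    N.PrecedesEq T T'' := by
  rcases h with h | rfl
  · rcases h' with h' | rfl
    · exact Or.inl (h.trans h')
    · exact Or.inl h
  · exact h'

theorem PrecedesEq.arr_le {T T' : Trip} (h : N.PrecedesEq T T') {i : ℕ} (hi : 1 ≤ i)
    (hl : i ≤ N.len T) : N.arr T i ≤ N.arr T' i := by
  rcases h with h | rfl
  · exact (h.2 i hi hl).1.le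
  · exact le_rfl

theorem precedesEq_or_precedes {T T' : Trip} (h : N.line T = N.line T') :
    N.PrecedesEq T T' ∨ N.Precedes T' T := by
  rcases N.line_total T T' h with h1 | h1 | h1
  · exact Or.inl (Or.inr h1)
  · exact Or.inl (Or.inl ⟨h, h1⟩)
  · exact Or.inr ⟨h.symm, fun i hi hl => h1 i hi (by rwa [len, ← h] at hl)⟩

theorem Precedes.irrefl (T : Trip) : ¬ N.Precedes T T := fun h =>
  lt_irrefl _ (h.2 1 le_rfl (N.lineLen_pos _)).1

/-- Every nonempty set of trips has a minimal element with respect to `≺`. -/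
theorem wellFounded_precedes [Finite Trip] : WellFounded (N.Precedes) := by
  have : Std.Irrefl N.Precedes := ⟨Precedes.irrefl⟩
  have : IsTrans Trip N.Precedes := ⟨fun _ _ _ => Precedes.trans⟩
  exact Finite.wellFounded_of_trans_of_irrefl _

/-! ### Continuing a journey to a fixed target -/

variable (N)

/-- A passenger who is at stop `q` at time `θ` can be at the target `pt` at time `A` or before,
using at most `r` trips. The transfers are only required to be feasible; they need not belong to a
precomputed transfer set. -/
def Reaches (pt : Stop) (A : ℤ) : ℕ → Stop → ℤ → Prop
  | 0, q, θ => N.foot q pt ∧ θ + N.walk q pt ≤ A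
  | r + 1, q, θ => (N.foot q pt ∧ θ + N.walk q pt ≤ A) ∨
      ∃ W w, 1 ≤ w ∧ N.foot q (N.stopOf (W, w)) ∧ θ + N.walk q (N.stopOf (W, w)) ≤ N.dep W w ∧
        ∃ x, w < x ∧ x ≤ N.len W ∧ Reaches pt A r (N.stopOf (W, x)) (N.arr W x)

/-- A passenger who has entered trip `T` at index `i` can be at the target `pt` at time `A` or
before, using at most `r` trips besides `T`. -/
def Boards (pt : Stop) (A : ℤ) (r : ℕ) (T : Trip) (i : ℕ) : Prop :=
  ∃ x, i < x ∧ x ≤ N.len T ∧ N.Reaches pt A r (N.stopOf (T, x)) (N.arr T x)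

variable {N} {pt : Stop} {A : ℤ}

theorem Reaches.of_walk {r : ℕ} {q : Stop} {θ : ℤ} (hf : N.foot q pt)
    (h : θ + N.walk q pt ≤ A) : N.Reaches pt A r q θ := by
  cases r
  · exact ⟨hf, h⟩
  · exact Or.inl ⟨hf, h⟩

theorem Reaches.of_boards {r : ℕ} {q : Stop} {θ : ℤ} {W : Trip} {w : ℕ} (hw : 1 ≤ w)
    (hf : N.foot q (N.stopOf (W, w))) (h : θ + N.walk q (N.stopOf (W, w)) ≤ N.dep W w)
    (hb : N.Boards pt A r W w) : N.Reaches pt A (r + 1) q θ :=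
  Or.inr ⟨W, w, hw, hf, h, hb⟩

theorem Reaches.succ {r : ℕ} {q : Stop} {θ : ℤ} (h : N.Reaches pt A r q θ) :
    N.Reaches pt A (r + 1) q θ := by
  induction r generalizing q θ with
  | zero => exact Or.inl h
  | succ r ih =>
    rcases h with h | ⟨W, w, hw, hf, hd, x, hx, hl, h⟩
    · exact Or.inl h
    · exact Or.inr ⟨W, w, hw, hf, hd, x, hx, hl, ih h⟩

/-- Starting from a place from which `q` can be reached in time on foot is no worse than starting
from `q`. -/
theorem Reaches.of_foot {r : ℕ} {q q' : Stop} {θ θ' : ℤ} (hf : N.foot q' q)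
    (hθ : θ' + N.walk q' q ≤ θ) (h : N.Reaches pt A r q θ) : N.Reaches pt A r q' θ' := by
  have key : ∀ p, N.foot q p → θ' + N.walk q' p ≤ θ + N.walk q p := fun p hp => by
    have := N.walk_triangle q' q p hf hp
    omega
  cases r with
  | zero => exact ⟨N.foot_trans _ _ _ hf h.1, (key _ h.1).trans h.2⟩
  | succ r =>
    rcases h with h | ⟨W, w, hw, hf', hd, h⟩
    · exact Or.inl ⟨N.foot_trans _ _ _ hf h.1, (key _ h.1).trans h.2⟩
    · exact Or.inr ⟨W, w, hw, N.foot_trans _ _ _ hf hf', (key _ hf').trans hd, h⟩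

theorem Reaches.mono_time {r : ℕ} {q : Stop} {θ θ' : ℤ} (hθ : θ' ≤ θ)
    (h : N.Reaches pt A r q θ) : N.Reaches pt A r q θ' :=
  h.of_foot (N.foot_refl q) (by simpa [N.walk_self] using hθ)

theorem Reaches.time_le {r : ℕ} {q : Stop} {θ : ℤ} (h : N.Reaches pt A r q θ) : θ ≤ A := by
  induction r generalizing q θ with
  | zero => have := h.2; omega
  | succ r ih =>
    rcases h with h | ⟨W, w, hw, -, hd, x, hx, hl, h⟩
    · have := h.2; omega
    · have h1 := ih h
      have h2 := N.dep_le_arr_of_lt hw hx hl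
      omega

/-- An earlier trip of the same line that is entered at an earlier index is no worse. -/
theorem Boards.of_precedesEq {r : ℕ} {T T' : Trip} {i x : ℕ} (hT : N.PrecedesEq T' T)
    (hi : i < x) (hl : x ≤ N.len T)
    (h : N.Reaches pt A r (N.stopOf (T, x)) (N.arr T x)) : N.Boards pt A r T' i := by
  have hl' : x ≤ N.len T' := hT.len_eq ▸ hl
  refine ⟨x, hi, hl', ?_⟩
  rw [hT.stopOf_eq]
  exact h.mono_time (hT.arr_le (by omega) hl')

theorem Boards.mono {r : ℕ} {T T' : Trip} {i i' : ℕ} (hT : N.PrecedesEq T' T) (hi : i' ≤ i)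
    (h : N.Boards pt A r T i) : N.Boards pt A r T' i' := by
  obtain ⟨x, hx, hl, h⟩ := h
  exact Boards.of_precedesEq hT (by omega) hl h

/-- Changing trips by a feasible transfer. -/
theorem Boards.of_transfer {r : ℕ} {T W : Trip} {i x w : ℕ} (hi : i < x)
    (ht : N.IsTransfer ((T, x), (W, w))) (h : N.Boards pt A r W w) :
    N.Boards pt A (r + 1) T i :=
  ⟨x, hi, ht.1.2, Reaches.of_boards ht.2.1.1 ht.2.2.1 ht.2.2.2 h⟩

end Network

end TREX

namespace TREX

namespace Network

variable {Stop Trip Line : Type*} {N : Network Stop Trip Line} {pt : Stop} {A : ℤ}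

/-! ### Completeness of the precomputed transfers -/

theorem isCandidate_of_mem_generated {g : GenerationScheme} {t : Transfer Trip}
    (h : t ∈ N.generated g) : N.IsCandidate t := by
  cases g <;> exact h.1

theorem PruneStep.subset {𝔗 𝔗' : Set (Transfer Trip)} (h : N.PruneStep 𝔗 𝔗') : 𝔗' ⊆ 𝔗 := by
  cases h <;> exact Set.sdiff_subset

theorem isCandidate_of_reflTransGen {g : GenerationScheme} {𝔗 : Set (Transfer Trip)}
    (h : Relation.ReflTransGen N.PruneStep (N.generated g) 𝔗) {t : Transfer Trip} (ht : t ∈ 𝔗) :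
    N.IsCandidate t := by
  induction h with
  | refl => exact isCandidate_of_mem_generated ht
  | tail _ h ih => exact ih (h.subset ht)

theorem IsPrecomputed.isCandidate {𝔗 : Set (Transfer Trip)} (h : N.IsPrecomputed 𝔗)
    {t : Transfer Trip} (ht : t ∈ 𝔗) : N.IsCandidate t := by
  obtain ⟨g, h⟩ := h
  exact isCandidate_of_reflTransGen h ht

variable (N pt A) in
/-- A passenger who has entered trip `U` at index `u` does not need transfers outside `𝔗` in order
to use `r` trips besides `U` and one more: there is a suitable transfer of `𝔗`, or one trip can be
saved by staying on `U`, or one trip can be saved by not entering `U` at all and continuing from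
the stop `U[u]`, at the departure time of `U` there. The last case is that of a U-turn right after
the entry. -/
def HasAlternative (𝔗 : Set (Transfer Trip)) (r : ℕ) (U : Trip) (u : ℕ) : Prop :=
  (∃ x W w, u < x ∧ ((U, x), (W, w)) ∈ 𝔗 ∧ N.Boards pt A r W w) ∨ N.Boards pt A r U u ∨
    N.Reaches pt A (r + 1) (N.stopOf (U, u)) (N.dep U u)

variable (N pt A) in
/-- Feasible transfers can be replaced by transfers of `𝔗` without arriving later at the target. -/
def IsComplete (𝔗 : Set (Transfer Trip)) : Prop :=
  ∀ r U u x V v, 1 ≤ u → u < x → N.IsTransfer ((U, x), (V, v)) → N.Boards pt A r V v →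
    N.HasAlternative pt A 𝔗 r U u

theorem Boards.lt_len {r : ℕ} {V : Trip} {v : ℕ} (h : N.Boards pt A r V v) : v < N.len V := by
  obtain ⟨x, hx, hl, -⟩ := h
  omega

theorem Boards.alternative_of_generated {𝔗 : Set (Transfer Trip)} {r : ℕ} {U T : Trip}
    {u x v : ℕ} (hu : 1 ≤ u) (hx : u < x) (ht : N.IsTransfer ((U, x), (T, v)))
    (hb : N.Boards pt A r T v) (h : N.IsCandidate ((U, x), (T, v)) → ((U, x), (T, v)) ∈ 𝔗) :
    N.HasAlternative pt A 𝔗 r U u := by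
  by_cases hs : N.PrecedesEq U T ∧ x ≤ v
  · exact Or.inr (Or.inl (hb.mono hs.1 (by omega)))
  · refine Or.inl ⟨x, T, v, hx, h ⟨ht, ?_, hb.lt_len, hs⟩, hb⟩
    show 1 < x
    omega

theorem isComplete_generated [Finite Trip] (g : GenerationScheme) :
    N.IsComplete pt A (N.generated g) := by
  intro r U u x V v hu hx ht hb
  cases g with
  | earliestTrip =>
    obtain ⟨T, ⟨hTV, hT⟩, hmin⟩ := wellFounded_precedes.has_min
      {T | N.PrecedesEq T V ∧ N.IsTransfer ((U, x), (T, v))} ⟨V, PrecedesEq.refl V, ht⟩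
    refine Boards.alternative_of_generated hu hx hT (hb.mono hTV le_rfl) fun hc => ⟨hc, ?_⟩
    exact fun T' hT' ht' => hmin T' ⟨PrecedesEq.trans (Or.inl hT') hTV, ht'⟩ hT'
  | undominated =>
    obtain ⟨T, ⟨hTV, x₁, v₁, hx₁, hv₁, hT₁⟩, hmin⟩ := wellFounded_precedes.has_min
      {T | N.PrecedesEq T V ∧ ∃ x' v', x ≤ x' ∧ v' ≤ v ∧ N.IsTransfer ((U, x'), (T, v'))}
      ⟨V, PrecedesEq.refl V, x, v, le_rfl, le_rfl, ht⟩
    -- Among the transfers to this trip, minimize the entry index and maximize the exit index.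
    obtain ⟨⟨x₀, v₀⟩, ⟨hx₀, hv₀, hT⟩, hmin'⟩ :=
      (measure (fun y : ℕ × ℕ => y.2 + (N.len U - y.1))).wf.has_min
      {y | x ≤ y.1 ∧ y.2 ≤ v ∧ N.IsTransfer ((U, y.1), (T, y.2))} ⟨(x₁, v₁), hx₁, hv₁, hT₁⟩
    refine Boards.alternative_of_generated hu (hx.trans_le hx₀) hT (hb.mono hTV hv₀)
      fun hc => ⟨hc, ?_⟩
    rintro ⟨⟨U', x'⟩, ⟨T', v'⟩⟩ ht' hU' hx' hv' hT'
    simp only at hU' hx' hv' hT' hx₀ hv₀ hT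
    subst hU'
    have hTT : T' = T := hT'.resolve_left fun h =>
      hmin T' ⟨hT'.trans hTV, x', v', hx₀.trans hx', hv'.trans hv₀, ht'⟩ h
    subst hTT
    have h1 : ¬ v' + (N.len U' - x') < v₀ + (N.len U' - x₀) :=
      hmin' (x', v') ⟨hx₀.trans hx', hv'.trans hv₀, ht'⟩
    have h2 : x' ≤ N.len U' := ht'.1.2
    have h3 : x' = x₀ := by omega
    have h4 : v' = v₀ := by omega
    rw [h3, h4]

/-- A U-turn back to the stop at which the first trip was entered: a passenger who can enter `U`
there can instead wait for `V`. Departure times may have the minimum change time subtracted, but at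
both events it is that of the same stop, so it cancels. -/
theorem dep_le_dep_of_uTurn {U V : Trip} {u v : ℕ} (hu : 1 ≤ u)
    (ht : N.IsTransfer ((U, u + 1), (V, v))) (hv : v < N.len V)
    (same : N.stopOf (U, u) = N.stopOf (V, v + 1)) : N.dep U u ≤ N.dep V (v + 1) := by
  obtain ⟨⟨-, h1⟩, ⟨h2, -⟩, -, h3⟩ := ht
  simp only at h1 h2 h3
  have h4 := N.dep_le_arr U u hu h1
  have h5 := N.dep_le_arr V v h2 hv
  have h6 := N.arr_le_dep V (v + 1) (by omega) hv
  simp only [stopOf] at same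
  rw [same] at h4
  omega

theorem PruneStep.isComplete {𝔗 𝔗' : Set (Transfer Trip)} (hc : ∀ t ∈ 𝔗, N.IsCandidate t)
    (h : N.PruneStep 𝔗 𝔗') (h𝔗 : N.IsComplete pt A 𝔗) : N.IsComplete pt A 𝔗' := by
  intro r U u x V v hu hx ht hb
  rcases h𝔗 r U u x V v hu hx ht hb with ⟨x', W, w, hx', hm, hW⟩ | h2
  swap
  · exact Or.inr h2
  have hcand := hc _ hm
  cases h with
  | uTurn Ta Tb j i mem same mem' =>
    -- If the removed transfer is needed, exit one stop earlier and enter one stop later, and omit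
    -- each of the two trips on which no ride is left.
    by_cases heq : (((U, x'), (W, w)) : Transfer Trip) = ((Ta, j + 1), (Tb, i))
    · simp only [Prod.mk.injEq] at heq
      obtain ⟨⟨rfl, rfl⟩, rfl, rfl⟩ := heq
      have hcand' := hc _ mem'
      obtain ⟨z, hz, hl, hr⟩ := hW
      rcases Nat.lt_or_ge u j with huj | huj
      · rcases Nat.lt_or_ge (w + 1) z with hz' | hz'
        · refine Or.inl ⟨j, W, w + 1, huj, ⟨mem', ?_⟩, z, hz', hl, hr⟩
          simp
        · obtain rfl : z = w + 1 := by omega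
          refine Or.inr (Or.inl ⟨j, huj, hcand'.1.1.2, ?_⟩)
          rw [same]
          refine hr.mono_time ?_
          have h1 := N.arr_mono (T := U) (i := j) (j := j + 1) (by omega) (by omega)
            hcand.1.1.2
          have h2 := hcand.1.2.2.2
          have h3 := N.dep_le_arr_of_lt (T := W) (i := w) (j := w + 1) hcand.1.2.1.1 (by omega) hl
          simp only at h2
          omega
      · obtain rfl : u = j := by omega
        refine Or.inr (Or.inr ?_)
        have hd := dep_le_dep_of_uTurn hu hcand.1 (hcand.2.2.1) same
        rcases Nat.lt_or_ge (w + 1) z with hz' | hz'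
        · refine Reaches.of_boards (W := W) (w := w + 1) (by omega) ?_ ?_ ⟨z, hz', hl, hr⟩
          · rw [same]; exact N.foot_refl _
          · rw [same, N.walk_self]; simpa using hd
        · obtain rfl : z = w + 1 := by omega
          rw [same]
          refine (hr.mono_time ?_).succ
          have h1 := N.dep_le_arr_of_lt (T := U) (i := u) (j := u + 1) hu (by omega)
            hcand.1.1.2
          have h2 := hcand.1.2.2.2
          have h3 := N.dep_le_arr_of_lt (T := W) (i := w) (j := w + 1) hcand.1.2.1.1 (by omega) hl
          simp only at h2
          omega
    · exact Or.inl ⟨x', W, w, hx', ⟨hm, heq⟩, hW⟩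
  | latestExit Ta Tb j i mem dominated =>
    by_cases heq : (((U, x'), (W, w)) : Transfer Trip) = ((Ta, j), (Tb, i))
    · simp only [Prod.mk.injEq] at heq
      obtain ⟨⟨rfl, rfl⟩, rfl, rfl⟩ := heq
      obtain ⟨z, hz, hl, hr⟩ := hW
      obtain ⟨j', hj', hjl, ⟨hf, ha⟩ | ⟨Tc, i', l', hm', hi', hl', hf, ha⟩⟩ := dominated z hz hl
      · exact Or.inr (Or.inl ⟨j', by omega, hjl, hr.of_foot hf ha⟩)
      · refine Or.inl ⟨j', Tc, i', by omega, ⟨hm', ?_⟩, l', hi', hl', hr.of_foot hf ha⟩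
        simp only [Set.mem_singleton_iff, Prod.mk.injEq, not_and]
        omega
    · exact Or.inl ⟨x', W, w, hx', ⟨hm, heq⟩, hW⟩

/-- Neither the generation schemes nor the pruning rules lose optimal journeys. -/
theorem IsPrecomputed.isComplete [Finite Trip] {𝔗 : Set (Transfer Trip)}
    (h : N.IsPrecomputed 𝔗) : N.IsComplete pt A 𝔗 := by
  obtain ⟨g, h⟩ := h
  induction h with
  | refl => exact isComplete_generated g
  | tail h h' ih => exact h'.isComplete (fun _ => isCandidate_of_reflTransGen h) ih

end Network

end TREX

namespace TREX

/-! ### Searches as sequences of enqueue operations -/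

/-- A request to enqueue a trip segment: the event at which the trip is entered, and the trip
segments that lead to it. -/
abbrev Request (Trip : Type*) := StopEvent Trip × List (Leg Trip)

namespace Network

variable {Stop Trip Line : Type*} (N : Network Stop Trip Line)

/-- Process a list of requests. -/
noncomputable def enqueueAll (R : List (Request Trip)) (f : Frontier Trip) : Frontier Trip :=
  R.foldl (fun f r => N.enqueue r.1.1 r.1.2 r.2 f) f

open Classical in
/-- The requests that are made when the outgoing transfers of a queue are relaxed, in the order in
which they are made. -/
noncomputable def requests {𝔗 : Set (Transfer Trip)} (O : N.ScanOrder 𝔗)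
    (allowed : Transfer Trip → Prop) (exits : QueueElem Trip → List ℕ)
    (Q : List (QueueElem Trip)) : List (Request Trip) :=
  Q.flatMap fun s => (exits s).flatMap fun i =>
    ((O.transfers (s.trip, i)).filter fun e => decide (allowed ((s.trip, i), e))).map
      fun e => (e, s.journey i)

open Classical in
/-- The requests that are made before the first queue of a query is complete. -/
noncomputable def initialRequests {𝔗 : Set (Transfer Trip)} (O : N.ScanOrder 𝔗) (ps : Stop)
    (τ : ℤ) : List (Request Trip) :=
  (O.footpaths ps).flatMap fun q => O.lines.flatMap fun L =>
    (List.range' 1 (N.lineLen L - 1)).flatMap fun i =>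
      if h : N.lineStop L i = q ∧ ∃ T, N.IsEarliestTrip L i (τ + N.walk ps q) T then
        [((h.2.choose, i), [])]
      else []

variable {N}

theorem enqueueAll_append (R R' : List (Request Trip)) (f : Frontier Trip) :
    N.enqueueAll (R ++ R') f = N.enqueueAll R' (N.enqueueAll R f) :=
  List.foldl_append ..

theorem enqueueAll_cons (r : Request Trip) (R : List (Request Trip)) (f : Frontier Trip) :
    N.enqueueAll (r :: R) f = N.enqueueAll R (N.enqueue r.1.1 r.1.2 r.2 f) := rfl

theorem relax_eq {𝔗 : Set (Transfer Trip)} (O : N.ScanOrder 𝔗)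
    (allowed : Transfer Trip → Prop) (exits : QueueElem Trip → List ℕ)
    (Q : List (QueueElem Trip)) (reached : Trip → ℕ) :
    N.relax O allowed exits Q reached =
      N.enqueueAll (N.requests O allowed exits Q) ⟨reached, []⟩ := by
  simp only [relax, enqueueAll, requests, List.foldl_flatMap, List.foldl_map, List.foldl_filter]
  congr! 8
  funext e
  split_ifs <;> simp_all

theorem initialFrontier_eq {𝔗 : Set (Transfer Trip)} (O : N.ScanOrder 𝔗) (ps : Stop) (τ : ℤ) :
    N.initialFrontier O ps τ = N.enqueueAll (N.initialRequests O ps τ) N.emptyFrontier := by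
  simp only [initialFrontier, enqueueAll, initialRequests, List.foldl_flatMap]
  congr 1
  funext f q
  congr 1
  funext f L
  congr 1
  funext f i
  unfold enterLine
  split <;> rfl

theorem mem_requests {𝔗 : Set (Transfer Trip)} {O : N.ScanOrder 𝔗}
    {allowed : Transfer Trip → Prop} {exits : QueueElem Trip → List ℕ}
    {Q : List (QueueElem Trip)} {r : Request Trip} :
    r ∈ N.requests O allowed exits Q ↔ ∃ s ∈ Q, ∃ i ∈ exits s,
      ((s.trip, i), r.1) ∈ 𝔗 ∧ allowed ((s.trip, i), r.1) ∧ r.2 = s.journey i := by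
  simp only [requests, List.mem_flatMap, List.mem_map, List.mem_filter, decide_eq_true_eq,
    O.mem_transfers]
  constructor
  · rintro ⟨s, hs, i, hi, e, ⟨he, ha⟩, rfl⟩
    exact ⟨s, hs, i, hi, he, ha, rfl⟩
  · rintro ⟨s, hs, i, hi, he, ha, hr⟩
    exact ⟨s, hs, i, hi, r.1, ⟨he, ha⟩, by rw [← hr]⟩

theorem mem_initialRequests {𝔗 : Set (Transfer Trip)} {O : N.ScanOrder 𝔗} {ps : Stop} {τ : ℤ}
    {r : Request Trip} (h : r ∈ N.initialRequests O ps τ) :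
    1 ≤ r.1.2 ∧ r.1.2 < N.len r.1.1 ∧ N.foot ps (N.stopOf r.1) ∧
      τ + N.walk ps (N.stopOf r.1) ≤ N.dep r.1.1 r.1.2 ∧ r.2 = [] := by
  simp only [initialRequests, List.mem_flatMap] at h
  obtain ⟨q, hq, L, -, i, hi, h⟩ := h
  rw [O.mem_footpaths] at hq
  rw [List.mem_range'_1] at hi
  split_ifs at h with hc
  · rw [List.mem_singleton] at h
    subst h
    obtain ⟨hL, hd, -⟩ := hc.2.choose_spec
    have hqeq : N.stopOf (hc.2.choose, i) = q := by rw [stopOf]; simp only; rw [hL, hc.1]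
    refine ⟨hi.1, ?_, ?_, ?_, rfl⟩
    · simp only [len, hL]; omega
    · simpa only [hqeq] using hq
    · simpa only [hqeq] using hd
  · simp at h

/-- A trip that can be entered at the start is requested, or an earlier one of its line is. -/
theorem exists_mem_initialRequests [Finite Trip] {𝔗 : Set (Transfer Trip)} (O : N.ScanOrder 𝔗)
    {ps : Stop} {τ : ℤ} {W : Trip} {w : ℕ} (hw : 1 ≤ w) (hl : w < N.len W)
    (hf : N.foot ps (N.stopOf (W, w))) (hd : τ + N.walk ps (N.stopOf (W, w)) ≤ N.dep W w) :
    ∃ r ∈ N.initialRequests O ps τ, N.PrecedesEq r.1.1 W ∧ r.1.2 = w := by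
  have hex : ∃ T, N.IsEarliestTrip (N.line W) w (τ + N.walk ps (N.stopOf (W, w))) T := by
    obtain ⟨T, ⟨h1, h2⟩, hmin⟩ := wellFounded_precedes.has_min
      {T | N.line T = N.line W ∧ τ + N.walk ps (N.stopOf (W, w)) ≤ N.dep T w} ⟨W, rfl, hd⟩
    exact ⟨T, h1, h2, fun T' hT' h => hmin T' ⟨hT'.1.trans h1, h⟩ hT'⟩
  have hc : N.lineStop (N.line W) w = N.stopOf (W, w) ∧
      ∃ T, N.IsEarliestTrip (N.line W) w (τ + N.walk ps (N.stopOf (W, w))) T := ⟨rfl, hex⟩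
  refine ⟨((hc.2.choose, w), []), ?_, ?_, rfl⟩
  · simp only [initialRequests, List.mem_flatMap]
    refine ⟨_, (O.mem_footpaths _ _).2 hf, N.line W, O.mem_lines _, w, ?_, ?_⟩
    · rw [List.mem_range'_1]
      simp only [len] at hl
      omega
    · rw [dif_pos hc]
      exact List.mem_singleton.2 rfl
  · obtain ⟨hL, -, hmin⟩ := hc.2.choose_spec
    rcases precedesEq_or_precedes hL with h | h
    · exact h
    · exact absurd hd (hmin W h)

/-! ### Reached indices -/

theorem enqueue_reached_le (T : Trip) (i : ℕ) (p : List (Leg Trip)) (f : Frontier Trip)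
    (T' : Trip) : (N.enqueue T i p f).reached T' ≤ f.reached T' := by
  unfold enqueue
  split_ifs
  · exact le_rfl
  · dsimp only
    split_ifs
    · exact min_le_left _ _
    · exact le_rfl

theorem enqueue_reached_self (T : Trip) (i : ℕ) (p : List (Leg Trip)) (f : Frontier Trip) :
    (N.enqueue T i p f).reached T ≤ i + 1 := by
  unfold enqueue
  split_ifs with h
  · exact h
  · dsimp only
    rw [if_pos (PrecedesEq.refl T)]
    exact min_le_right _ _

theorem prefix_enqueue_queue (T : Trip) (i : ℕ) (p : List (Leg Trip)) (f : Frontier Trip) :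
    f.queue <+: (N.enqueue T i p f).queue := by
  unfold enqueue
  split_ifs
  · exact List.prefix_rfl
  · exact List.prefix_append _ _

theorem enqueueAll_reached_le (R : List (Request Trip)) (f : Frontier Trip) (T : Trip) :
    (N.enqueueAll R f).reached T ≤ f.reached T := by
  induction R generalizing f with
  | nil => exact le_rfl
  | cons r R ih => exact (ih _).trans (enqueue_reached_le ..)

theorem enqueueAll_reached_of_mem {R : List (Request Trip)} {f : Frontier Trip}
    {r : Request Trip} (h : r ∈ R) : (N.enqueueAll R f).reached r.1.1 ≤ r.1.2 + 1 := by
  obtain ⟨R₁, R₂, rfl⟩ := List.append_of_mem h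
  rw [enqueueAll_append, enqueueAll_cons]
  exact (enqueueAll_reached_le ..).trans (enqueue_reached_self ..)

theorem prefix_enqueueAll_queue (R : List (Request Trip)) (f : Frontier Trip) :
    f.queue <+: (N.enqueueAll R f).queue := by
  induction R generalizing f with
  | nil => exact List.prefix_rfl
  | cons r R ih => exact (prefix_enqueue_queue ..).trans (ih _)

/-- Each queue element comes from a request that was not pruned; the elements in front of it are
those that were enqueued before that request. -/
theorem enqueueAll_queue_split {R : List (Request Trip)} {f : Frontier Trip} (hf : f.queue = [])
    {l₁ l₂ : List (QueueElem Trip)} {s : QueueElem Trip}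
    (h : (N.enqueueAll R f).queue = l₁ ++ s :: l₂) :
    ∃ R₁ r R₂, R = R₁ ++ r :: R₂ ∧ (N.enqueueAll R₁ f).queue = l₁ ∧
      r.1.2 + 1 < (N.enqueueAll R₁ f).reached r.1.1 ∧
      s = ⟨r.1.1, r.1.2, (N.enqueueAll R₁ f).reached r.1.1 - 1, r.2⟩ := by
  induction R using List.reverseRecOn generalizing l₂ with
  | nil => simp [enqueueAll, hf] at h
  | append_singleton R r ih =>
    have old : ∀ l₂, (N.enqueueAll R f).queue = l₁ ++ s :: l₂ →
        ∃ R₁ r' R₂, R ++ [r] = R₁ ++ r' :: R₂ ∧ (N.enqueueAll R₁ f).queue = l₁ ∧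
          r'.1.2 + 1 < (N.enqueueAll R₁ f).reached r'.1.1 ∧
          s = ⟨r'.1.1, r'.1.2, (N.enqueueAll R₁ f).reached r'.1.1 - 1, r'.2⟩ := by
      intro l₂ h
      obtain ⟨R₁, r', R₂, h1, h2⟩ := ih h
      exact ⟨R₁, r', R₂ ++ [r], by simp [h1], h2⟩
    rw [enqueueAll_append, enqueueAll_cons] at h
    change (N.enqueue r.1.1 r.1.2 r.2 (N.enqueueAll R f)).queue = _ at h
    unfold enqueue at h
    split_ifs at h with hr
    · exact old _ h
    · dsimp only at h
      rcases List.eq_nil_or_concat l₂ with rfl | ⟨l₂, s', rfl⟩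
      · obtain ⟨h1, h2⟩ := List.append_inj' h rfl
        exact ⟨R, r, [], rfl, h1, not_le.1 hr, (List.cons.inj h2).1.symm⟩
      · rw [List.concat_eq_append, ← List.cons_append, ← List.append_assoc] at h
        exact old _ (List.append_inj_left' h rfl)

variable (N) in
/-- The elements of `H` account for the reached indices: if some index of a trip is reached, then the
first one is the index after the entry of an element of `H` with this trip or an earlier one of its
line. -/
structure IsReachedBy (H : Set (QueueElem Trip)) (reached : Trip → ℕ) : Prop where
  le_len : ∀ T, reached T ≤ N.len T + 1
  exists_mem : ∀ T, reached T ≤ N.len T →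
    ∃ s ∈ H, N.PrecedesEq s.trip T ∧ reached T = s.entry + 1

theorem IsReachedBy.enqueue {H : Set (QueueElem Trip)} {f : Frontier Trip} {T : Trip} {i : ℕ}
    {p : List (Leg Trip)} (h : N.IsReachedBy (H ∪ {s | s ∈ f.queue}) f.reached) :
    N.IsReachedBy (H ∪ {s | s ∈ (N.enqueue T i p f).queue}) (N.enqueue T i p f).reached := by
  refine ⟨fun T' => (enqueue_reached_le ..).trans (h.le_len T'), fun T' hT' => ?_⟩
  have old : f.reached T' ≤ N.len T' → ∃ s ∈ H ∪ {s | s ∈ (N.enqueue T i p f).queue},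
      N.PrecedesEq s.trip T' ∧ f.reached T' = s.entry + 1 := by
    intro h'
    obtain ⟨s, hs, h'⟩ := h.exists_mem T' h'
    exact ⟨s, hs.imp_right fun h => (prefix_enqueue_queue ..).subset h, h'⟩
  by_cases heq : (N.enqueue T i p f).reached T' = f.reached T'
  · rw [heq] at hT' ⊢
    exact old hT'
  · unfold Network.enqueue at heq ⊢
    split_ifs at heq ⊢ with h1
    · exact absurd rfl heq
    · dsimp only at heq ⊢
      split_ifs at heq ⊢ with h2
      · refine ⟨⟨T, i, f.reached T - 1, p⟩, Or.inr (by simp), h2, ?_⟩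
        dsimp only
        omega
      · exact absurd rfl heq

theorem IsReachedBy.enqueueAll {H : Set (QueueElem Trip)} {R : List (Request Trip)}
    {f : Frontier Trip} (h : N.IsReachedBy (H ∪ {s | s ∈ f.queue}) f.reached) :
    N.IsReachedBy (H ∪ {s | s ∈ (N.enqueueAll R f).queue}) (N.enqueueAll R f).reached := by
  induction R generalizing f with
  | nil => exact h
  | cons r R ih => exact ih h.enqueue

variable (N) in
/-- The frontier at the start of round `k`, if `F` are the frontiers at the ends of the rounds. -/
def roundStart (F : ℕ → Frontier Trip) : ℕ → Frontier Trip
  | 0 => N.emptyFrontier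
  | k + 1 => ⟨(F k).reached, []⟩

variable (N) in
/-- The rounds of a search: round `k` processes the requests `R k` and thereby fills a new queue;
the reached indices are kept between the rounds. -/
structure IsSearch (F : ℕ → Frontier Trip) (R : ℕ → List (Request Trip)) : Prop where
  eq : ∀ k, F k = N.enqueueAll (R k) (N.roundStart F k)
  valid : ∀ k, ∀ r ∈ R k, 1 ≤ r.1.2 ∧ r.1.2 < N.len r.1.1

namespace IsSearch

variable {F : ℕ → Frontier Trip} {R : ℕ → List (Request Trip)}

theorem roundStart_queue (k : ℕ) : (N.roundStart F k).queue = [] := by cases k <;> rfl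

theorem isReachedBy_roundStart (h : N.IsSearch F R) (k : ℕ) :
    N.IsReachedBy {s | ∃ j < k, s ∈ (F j).queue} (N.roundStart F k).reached := by
  induction k with
  | zero => exact ⟨fun _ => le_rfl, fun T hT => absurd hT (by simp [roundStart, emptyFrontier])⟩
  | succ k ih =>
    have h1 := IsReachedBy.enqueueAll (R := R k) (f := N.roundStart F k)
      (H := {s | ∃ j < k, s ∈ (F j).queue}) (by simpa [roundStart_queue] using ih)
    rw [← h.eq] at h1
    refine ⟨h1.le_len, fun T hT => ?_⟩
    obtain ⟨s, hs, h2⟩ := h1.exists_mem T hT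
    refine ⟨s, ?_, h2⟩
    rcases hs with ⟨j, hj, hs⟩ | hs
    · exact ⟨j, by omega, hs⟩
    · exact ⟨k, by omega, hs⟩

theorem isReachedBy (h : N.IsSearch F R) (k : ℕ) (R' : List (Request Trip)) :
    N.IsReachedBy ({s | ∃ j < k, s ∈ (F j).queue} ∪
      {s | s ∈ (N.enqueueAll R' (N.roundStart F k)).queue})
      (N.enqueueAll R' (N.roundStart F k)).reached :=
  IsReachedBy.enqueueAll (by simpa [roundStart_queue] using h.isReachedBy_roundStart k)

/-- Once a request has been processed, its trip or an earlier one is boarded at the same index or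
before. -/
theorem exists_of_mem (h : N.IsSearch F R) {k : ℕ} {R' : List (Request Trip)} {r : Request Trip}
    (hr : r ∈ R') (hl : r.1.2 < N.len r.1.1) :
    ∃ s, (s ∈ (N.enqueueAll R' (N.roundStart F k)).queue ∨ ∃ j < k, s ∈ (F j).queue) ∧
      N.PrecedesEq s.trip r.1.1 ∧ s.entry ≤ r.1.2 := by
  have h1 := enqueueAll_reached_of_mem (N := N) (f := N.roundStart F k) hr
  obtain ⟨s, hs, h2, h3⟩ := (h.isReachedBy k R').exists_mem r.1.1 (by omega)
  exact ⟨s, hs.symm, h2, by omega⟩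

theorem queue_split (h : N.IsSearch F R) {k : ℕ} {l₁ l₂ : List (QueueElem Trip)}
    {s : QueueElem Trip} (hs : (F k).queue = l₁ ++ s :: l₂) :
    ∃ R₁ r R₂, R k = R₁ ++ r :: R₂ ∧ (N.enqueueAll R₁ (N.roundStart F k)).queue = l₁ ∧
      r.1.2 + 1 < (N.enqueueAll R₁ (N.roundStart F k)).reached r.1.1 ∧
      s = ⟨r.1.1, r.1.2, (N.enqueueAll R₁ (N.roundStart F k)).reached r.1.1 - 1, r.2⟩ :=
  enqueueAll_queue_split (roundStart_queue k) (by rwa [← h.eq])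

theorem exists_request (h : N.IsSearch F R) {k : ℕ} {s : QueueElem Trip}
    (hs : s ∈ (F k).queue) : ∃ r ∈ R k, s.trip = r.1.1 ∧ s.entry = r.1.2 ∧ s.parents = r.2 := by
  obtain ⟨l₁, l₂, hs⟩ := List.append_of_mem hs
  obtain ⟨R₁, r, R₂, h1, -, -, rfl⟩ := h.queue_split hs
  exact ⟨r, by simp [h1], rfl, rfl, rfl⟩

theorem entry_pos (h : N.IsSearch F R) {k : ℕ} {s : QueueElem Trip}
    (hs : s ∈ (F k).queue) : 1 ≤ s.entry := by
  obtain ⟨r, hr, -, h2, -⟩ := h.exists_request hs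
  rw [h2]
  exact (h.valid k r hr).1

theorem last_le (h : N.IsSearch F R) {k : ℕ} {s : QueueElem Trip}
    (hs : s ∈ (F k).queue) : s.last ≤ N.len s.trip := by
  obtain ⟨l₁, l₂, hs⟩ := List.append_of_mem hs
  obtain ⟨R₁, r, R₂, -, -, -, rfl⟩ := h.queue_split hs
  have := (h.isReachedBy k R₁).le_len r.1.1
  dsimp only
  omega

/-- The part of a trip that is cut off when its segment is enqueued belongs to a segment of the same
trip or an earlier one that was enqueued before. -/
theorem exists_of_last_lt (h : N.IsSearch F R) {k : ℕ} {l₁ l₂ : List (QueueElem Trip)}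
    {s : QueueElem Trip} (hs : (F k).queue = l₁ ++ s :: l₂) {x : ℕ} (hx : s.last < x)
    (hl : x ≤ N.len s.trip) :
    ∃ s', (s' ∈ l₁ ∨ ∃ j < k, s' ∈ (F j).queue) ∧ N.PrecedesEq s'.trip s.trip ∧
      s'.entry < x := by
  obtain ⟨R₁, r, R₂, -, rfl, hr, rfl⟩ := h.queue_split hs
  dsimp only at hx hl ⊢
  obtain ⟨s', hs', h2, h3⟩ := (h.isReachedBy k R₁).exists_mem r.1.1 (by omega)
  exact ⟨s', hs'.symm, h2, by omega⟩

end IsSearch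

end Network

end TREX

namespace TREX

/-! ### Auxiliary facts on lists -/

theorem exists_of_flatMap_eq_append_cons {α β : Type*} {f : α → List β} {l : List α}
    {r₁ r₂ : List β} {r : β} (h : l.flatMap f = r₁ ++ r :: r₂) :
    ∃ l₁ a l₂ u₁ u₂, l = l₁ ++ a :: l₂ ∧ f a = u₁ ++ r :: u₂ ∧ r₁ = l₁.flatMap f ++ u₁ := by
  induction l generalizing r₁ with
  | nil => simp at h
  | cons a l ih =>
    rw [List.flatMap_cons, List.append_eq_append_iff] at h
    rcases h with ⟨v, rfl, h⟩ | ⟨v, h, h'⟩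
    · obtain ⟨l₁, a', l₂, u₁, u₂, rfl, h2, rfl⟩ := ih h
      exact ⟨a :: l₁, a', l₂, u₁, u₂, rfl, h2, by simp⟩
    · cases v with
      | nil =>
        obtain ⟨l₁, a', l₂, u₁, u₂, rfl, h2, h3⟩ := ih (r₁ := []) h'.symm
        refine ⟨a :: l₁, a', l₂, u₁, u₂, rfl, h2, ?_⟩
        rw [List.flatMap_cons, List.append_assoc, ← h3]
        simpa using h.symm
      | cons r' v =>
        obtain ⟨rfl, -⟩ := List.cons.inj h'
        exact ⟨[], a, l, r₁, v, rfl, h, rfl⟩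

theorem mem_left_of_range'_eq {a m b : ℕ} {l₁ l₂ : List ℕ} (h : List.range' a m = l₁ ++ b :: l₂)
    (x : ℕ) : x ∈ l₁ ↔ a ≤ x ∧ x < b := by
  have hs : (l₁ ++ b :: l₂).Pairwise (· < ·) := h ▸ List.pairwise_lt_range'
  rw [List.pairwise_append, List.pairwise_cons] at hs
  have hmem : ∀ y, y ∈ l₁ ++ b :: l₂ ↔ a ≤ y ∧ y < a + m := fun y => by
    rw [← h, List.mem_range'_1]
  constructor
  · intro hx
    exact ⟨((hmem x).1 (by simp [hx])).1, hs.2.2 x hx b (by simp)⟩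
  · rintro ⟨hx, hxb⟩
    have hb := (hmem b).1 (by simp)
    have := (hmem x).2 ⟨hx, by omega⟩
    rw [List.mem_append, List.mem_cons] at this
    rcases this with h | rfl | h
    · exact h
    · omega
    · have := hs.2.1.1 x h
      omega

theorem mem_takeWhile_of_le {p : ℕ → Bool} {l : List ℕ} (hl : l.Pairwise (· < ·)) {x : ℕ}
    (hx : x ∈ l) (hp : ∀ y ∈ l, y ≤ x → p y) : x ∈ l.takeWhile p := by
  induction l with
  | nil => simp at hx
  | cons a l ih =>
    rw [List.pairwise_cons] at hl
    rcases List.mem_cons.1 hx with rfl | hx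
    · rw [List.takeWhile_cons_of_pos (hp _ (by simp) le_rfl)]
      simp
    · rw [List.takeWhile_cons_of_pos (hp _ (by simp) (hl.1 x hx).le)]
      exact List.mem_cons_of_mem _
        (ih hl.2 hx fun y hy => hp y (List.mem_cons_of_mem _ hy))

theorem QueueElem.mem_exits {Trip : Type*} {s : QueueElem Trip} {x : ℕ} :
    x ∈ s.exits ↔ s.entry < x ∧ x ≤ s.last := by
  rw [exits, List.mem_range'_1]
  omega

namespace Network

variable {Stop Trip Line : Type*} {N : Network Stop Trip Line}

/-! ### The order of the requests -/

variable (N) in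
open Classical in
/-- The requests that are made before the transfer from `s` at exit `i` to the event after `t₁` is
examined: those of the queue elements `Q₁` in front of `s`, those of `s` at the exits `x₁` before
`i`, and those of the transfers `t₁` from `i`. -/
noncomputable def requestsBefore {𝔗 : Set (Transfer Trip)} (O : N.ScanOrder 𝔗)
    (allowed : Transfer Trip → Prop) (exits : QueueElem Trip → List ℕ)
    (Q₁ : List (QueueElem Trip)) (s : QueueElem Trip) (x₁ : List ℕ) (i : ℕ)
    (t₁ : List (StopEvent Trip)) : List (Request Trip) :=
  N.requests O allowed exits Q₁ ++
    (N.requests O allowed (fun _ => x₁) [s] ++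
      (t₁.filter fun e => decide (allowed ((s.trip, i), e))).map fun e => (e, s.journey i))

theorem mem_requestsBefore {𝔗 : Set (Transfer Trip)} {O : N.ScanOrder 𝔗}
    {allowed : Transfer Trip → Prop} {exits : QueueElem Trip → List ℕ}
    {Q₁ : List (QueueElem Trip)} {s : QueueElem Trip} {x₁ : List ℕ} {i : ℕ}
    {t₁ : List (StopEvent Trip)} {r : Request Trip} :
    r ∈ N.requestsBefore O allowed exits Q₁ s x₁ i t₁ ↔
      (∃ s' ∈ Q₁, ∃ j ∈ exits s', ((s'.trip, j), r.1) ∈ 𝔗 ∧ allowed ((s'.trip, j), r.1) ∧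
        r.2 = s'.journey j) ∨
      (∃ j ∈ x₁, ((s.trip, j), r.1) ∈ 𝔗 ∧ allowed ((s.trip, j), r.1) ∧ r.2 = s.journey j) ∨
      (r.1 ∈ t₁ ∧ allowed ((s.trip, i), r.1) ∧ r.2 = s.journey i) := by
  rw [requestsBefore, List.mem_append, List.mem_append, mem_requests, mem_requests]
  refine or_congr Iff.rfl (or_congr ?_ ?_)
  · simp only [List.mem_singleton, exists_eq_left]
  · simp only [List.mem_map, List.mem_filter, decide_eq_true_eq]
    constructor
    · rintro ⟨e, ⟨he, ha⟩, rfl⟩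
      exact ⟨he, ha, rfl⟩
    · rintro ⟨he, ha, hr⟩
      exact ⟨r.1, ⟨he, ha⟩, by rw [← hr]⟩

theorem exists_requests_eq {𝔗 : Set (Transfer Trip)} {O : N.ScanOrder 𝔗}
    {allowed : Transfer Trip → Prop} {exits : QueueElem Trip → List ℕ}
    {Q₁ Q₂ : List (QueueElem Trip)} {s : QueueElem Trip} {x₁ x₂ : List ℕ} {i : ℕ}
    {t₁ t₂ : List (StopEvent Trip)} {e : StopEvent Trip} (hx : exits s = x₁ ++ i :: x₂)
    (ht : O.transfers (s.trip, i) = t₁ ++ e :: t₂) (ha : allowed ((s.trip, i), e)) :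
    ∃ R₂, N.requests O allowed exits (Q₁ ++ s :: Q₂) =
      N.requestsBefore O allowed exits Q₁ s x₁ i t₁ ++ (e, s.journey i) :: R₂ := by
  simp only [requestsBefore, requests, List.flatMap_append, List.flatMap_cons, List.flatMap_nil,
    hx, ht, List.filter_append, List.map_append, List.filter_cons, ha, decide_true, if_true,
    List.map_cons, List.append_assoc, List.append_nil, List.cons_append, List.append_cancel_left_eq,
    List.cons.injEq, true_and, exists_eq']

theorem exists_of_requests_eq {𝔗 : Set (Transfer Trip)} {O : N.ScanOrder 𝔗}
    {allowed : Transfer Trip → Prop} {exits : QueueElem Trip → List ℕ}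
    {Q : List (QueueElem Trip)} {R₁ R₂ : List (Request Trip)} {r : Request Trip}
    (h : N.requests O allowed exits Q = R₁ ++ r :: R₂) :
    ∃ Q₁ s Q₂ x₁ i x₂ t₁ t₂, Q = Q₁ ++ s :: Q₂ ∧ exits s = x₁ ++ i :: x₂ ∧
      O.transfers (s.trip, i) = t₁ ++ r.1 :: t₂ ∧ r.2 = s.journey i ∧
      R₁ = N.requestsBefore O allowed exits Q₁ s x₁ i t₁ := by
  obtain ⟨Q₁, s, Q₂, u₁, u₂, h1, h2, rfl⟩ := exists_of_flatMap_eq_append_cons h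
  obtain ⟨x₁, i, x₂, v₁, v₂, h3, h4, rfl⟩ := exists_of_flatMap_eq_append_cons h2
  obtain ⟨w₁, w₂, h5, rfl, h6⟩ := List.map_eq_append_iff.1 h4
  obtain ⟨e, w₂, rfl, rfl, -⟩ := List.map_eq_cons_iff.1 h6
  obtain ⟨t₁, w₃, h7, rfl, h8⟩ := List.filter_eq_append_iff.1 h5
  obtain ⟨t₂, t₃, rfl, h9, -⟩ := List.filter_eq_cons_iff.1 h8
  refine ⟨Q₁, s, Q₂, x₁, i, x₂, t₁ ++ t₂, t₃, h1, h3, ?_, rfl, ?_⟩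
  · rw [h7, List.append_assoc]
  · simpa [requestsBefore, requests] using fun a b hab => by simpa using h9 (a, b) hab

/-! ### Optimality of a search -/

/-- One step of the optimality proof. If no element of the search allows a journey that reaches
the target `pt` by `A` with fewer than `M` trips, then no element of the prefixes `P k` of the
queues allows such a journey with `M` trips, provided that the transfers from `P k` lead to
`P (k + 1)` or to earlier queues, and that no element of the last prefix reaches `pt` by `A`. -/
theorem IsSearch.not_boards_of_prefix {F : ℕ → Frontier Trip} {R : ℕ → List (Request Trip)}
    (h : N.IsSearch F R) {𝔗 : Set (Transfer Trip)} {ps pt : Stop} {A τ : ℤ}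
    (htr : ∀ t ∈ 𝔗, N.IsTransfer t) (hc : N.IsComplete pt A 𝔗)
    (start : ∀ r ∈ R 0, N.foot ps (N.stopOf r.1) ∧
      τ + N.walk ps (N.stopOf r.1) ≤ N.dep r.1.1 r.1.2)
    (start_complete : ∀ W w, 1 ≤ w → w < N.len W → N.foot ps (N.stopOf (W, w)) →
      τ + N.walk ps (N.stopOf (W, w)) ≤ N.dep W w →
      ∃ s ∈ (F 0).queue, N.PrecedesEq s.trip W ∧ s.entry ≤ w)
    (parent : ∀ k, ∀ r ∈ R (k + 1), ∃ s ∈ (F k).queue, ∃ x, s.entry < x ∧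
      ((s.trip, x), r.1) ∈ 𝔗)
    (hwalk : N.foot ps pt → A < τ + N.walk ps pt) {M : ℕ}
    (fewer : ∀ k r, k + 1 + r < M → ∀ s ∈ (F k).queue, ¬ N.Boards pt A r s.trip s.entry)
    {P : ℕ → List (QueueElem Trip)} (hP : ∀ k < M, P k <+: (F k).queue)
    (next : ∀ k, k + 1 < M → ∀ s ∈ P k, ∀ x e, s.entry < x → x ≤ s.last →
      N.arr s.trip x ≤ A → ((s.trip, x), e) ∈ 𝔗 →
      ∃ s', (s' ∈ P (k + 1) ∨ ∃ j ≤ k, s' ∈ (F j).queue) ∧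
        N.PrecedesEq s'.trip e.1 ∧ s'.entry ≤ e.2)
    (final : ∀ k, k + 1 = M → ∀ s ∈ P k, ∀ x, s.entry < x → x ≤ s.last →
      N.foot (N.stopOf (s.trip, x)) pt → A < N.arr s.trip x + N.walk (N.stopOf (s.trip, x)) pt) :
    ∀ k r, k + 1 + r = M → ∀ s ∈ P k, ¬ N.Boards pt A r s.trip s.entry := by
  have init : ∀ r < M, ¬ N.Reaches pt A r ps τ := by
    intro r hr hreach
    cases r with
    | zero =>
      have := hwalk hreach.1
      have := hreach.2
      omega
    | succ r =>
      rcases hreach with hreach | ⟨W, w, hw, hf, hd, hb⟩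
      · have := hwalk hreach.1
        omega
      · have hb : N.Boards pt A r W w := hb
        obtain ⟨s, hs, h1, h2⟩ := start_complete W w hw hb.lt_len hf hd
        exact fewer 0 r (by omega) s hs (hb.mono h1 h2)
  intro k r
  induction r generalizing k with
  | zero =>
    intro hk s hmem
    obtain ⟨l₁, l₂, hs⟩ := List.append_of_mem hmem
    clear hmem
    induction hn : l₁.length using Nat.strong_induction_on generalizing s l₁ l₂ with
    | _ m ihl =>
    subst hn
    obtain ⟨l₃, hl₃⟩ := hP k (by omega)
    rw [hs, List.append_assoc, List.cons_append] at hl₃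
    rintro ⟨x, hx, hxl, hr⟩
    rcases Nat.lt_or_ge s.last x with hlast | hlast
    · obtain ⟨s', hs', h1, h2⟩ := h.exists_of_last_lt hl₃.symm hlast hxl
      have hb := Boards.of_precedesEq h1 h2 hxl hr
      rcases hs' with hs' | ⟨j, hj, hs'⟩
      · obtain ⟨m₁, m₂, rfl⟩ := List.append_of_mem hs'
        exact ihl m₁.length (by simp) s' m₁ (m₂ ++ s :: l₂) (by simpa using hs) rfl hb
      · exact fewer j 0 (by omega) s' hs' hb
    · have := final k hk s (by simp [hs]) x hx hlast hr.1
      have := hr.2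
      omega
  | succ r ih =>
    intro hk s hmem
    obtain ⟨l₁, l₂, hs⟩ := List.append_of_mem hmem
    clear hmem
    induction hn : l₁.length using Nat.strong_induction_on generalizing s l₁ l₂ with
    | _ m ihl =>
    subst hn
    obtain ⟨l₃, hl₃⟩ := hP k (by omega)
    rw [hs, List.append_assoc, List.cons_append] at hl₃
    have hsF : s ∈ (F k).queue := by simp [← hl₃]
    have cut : ∀ x, s.last < x → x ≤ N.len s.trip →
        ¬ N.Reaches pt A (r + 1) (N.stopOf (s.trip, x)) (N.arr s.trip x) := by
      intro x hlast hxl hr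
      obtain ⟨s', hs', h1, h2⟩ := h.exists_of_last_lt hl₃.symm hlast hxl
      have hb := Boards.of_precedesEq h1 h2 hxl hr
      rcases hs' with hs' | ⟨j, hj, hs'⟩
      · obtain ⟨m₁, m₂, rfl⟩ := List.append_of_mem hs'
        exact ihl m₁.length (by simp) s' m₁ (m₂ ++ s :: l₂) (by simpa using hs) rfl hb
      · exact fewer j (r + 1) (by omega) s' hs' hb
    rintro ⟨x, hx, hxl, hr⟩
    rcases hr with ⟨hf, ha⟩ | ⟨W, w, hw, hf, hd, hb⟩
    · exact fewer k 0 (by omega) s hsF ⟨x, hx, hxl, hf, ha⟩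
    have hb : N.Boards pt A r W w := hb
    have hu := h.entry_pos hsF
    have ht : N.IsTransfer ((s.trip, x), (W, w)) :=
      ⟨⟨show 1 ≤ x by omega, hxl⟩, ⟨hw, hb.lt_len.le⟩, hf, hd⟩
    rcases hc r s.trip s.entry x W w hu hx ht hb with
      ⟨x', W', w', hx', hm, hb'⟩ | hb' | hr'
    · have ht' := htr _ hm
      have hr' : N.Reaches pt A (r + 1) (N.stopOf (s.trip, x')) (N.arr s.trip x') :=
        Reaches.of_boards ht'.2.1.1 ht'.2.2.1 ht'.2.2.2 hb'
      rcases Nat.lt_or_ge s.last x' with hlast | hlast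
      · exact cut x' hlast ht'.1.2 hr'
      · obtain ⟨s', hs', h1, h2⟩ :=
          next k (by omega) s (by simp [hs]) x' (W', w') hx' hlast hr'.time_le hm
        have hb'' := hb'.mono h1 h2
        rcases hs' with hs' | ⟨j, hj, hs'⟩
        · exact ih (k + 1) (by omega) s' hs' hb''
        · exact fewer j r (by omega) s' hs' hb''
    · exact fewer k r (by omega) s hsF hb'
    · -- The trip of `s` is not needed: continue from the exit or the start that leads to it.
      obtain ⟨q, hq, h1, h2, -⟩ := h.exists_request hsF
      cases k with
      | zero =>
        obtain ⟨h3, h4⟩ := start q hq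
        refine init (r + 1) (by omega) (hr'.of_foot ?_ ?_)
        · rw [h1, h2]; exact h3
        · rw [h1, h2]; exact h4
      | succ k =>
        obtain ⟨p, hp, y, hy, hm⟩ := parent k q hq
        obtain ⟨h3, -, h4, h5⟩ := htr _ hm
        refine fewer k (r + 1) (by omega) p hp ⟨y, hy, h3.2, hr'.of_foot ?_ ?_⟩
        · rw [h1, h2]; exact h4
        · rw [h1, h2]; exact h5

end Network

end TREX

namespace TREX

namespace Network

variable {Stop Trip Line : Type*} {N : Network Stop Trip Line}

/-! ### The arrival time at the target during a TB query -/

theorem scanExits_fst_le (pt : Stop) (n : ℕ) (s : QueueElem Trip) (l : List ℕ)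
    (x : WithTop ℤ × List (Label Trip)) : (N.scanExits pt n s l x).1 ≤ x.1 := by
  induction l generalizing x with
  | nil => exact le_rfl
  | cons i l ih =>
    unfold scanExits
    split_ifs with h1
    · exact le_rfl
    · dsimp only
      split_ifs with h2
      · exact (ih _).trans h2.2.le
      · exact ih _

theorem scanExits_fst_le_of_mem {pt : Stop} {n : ℕ} {s : QueueElem Trip} {l : List ℕ}
    (hl : l.Pairwise (N.arr s.trip · ≤ N.arr s.trip ·)) (x : WithTop ℤ × List (Label Trip)) {i : ℕ}
    (hi : i ∈ l) (hf : N.foot (N.stopOf (s.trip, i)) pt) :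
    (N.scanExits pt n s l x).1 ≤
      ((N.arr s.trip i + N.walk (N.stopOf (s.trip, i)) pt : ℤ) : WithTop ℤ) := by
  induction l generalizing x with
  | nil => simp at hi
  | cons j l ih =>
    rw [List.pairwise_cons] at hl
    unfold scanExits
    split_ifs with h1
    · refine h1.trans (WithTop.coe_le_coe.2 ?_)
      have : N.arr s.trip j ≤ N.arr s.trip i := by
        rcases List.mem_cons.1 hi with rfl | hi
        · exact le_rfl
        · exact hl.1 i hi
      omega
    · dsimp only
      rcases List.mem_cons.1 hi with rfl | hi
      · split_ifs with h2
        · exact scanExits_fst_le ..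
        · exact (scanExits_fst_le ..).trans (not_lt.1 fun h3 => h2 ⟨hf, h3⟩)
      · split_ifs with h2
        · exact ih hl.2 _ hi
        · exact ih hl.2 _ hi

theorem mem_scanExits_snd {pt : Stop} {n : ℕ} {s : QueueElem Trip} {l : List ℕ}
    {x : WithTop ℤ × List (Label Trip)} {J : Label Trip}
    (h : J ∈ (N.scanExits pt n s l x).2) :
    J ∈ x.2 ∨ ∃ i ∈ l, N.foot (N.stopOf (s.trip, i)) pt ∧
      J.arrival = N.arr s.trip i + N.walk (N.stopOf (s.trip, i)) pt ∧
      J.journey = s.journey i ∧ (J.arrival : WithTop ℤ) < x.1 := by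
  induction l generalizing x with
  | nil => exact Or.inl h
  | cons j l ih =>
    unfold scanExits at h
    split_ifs at h with h1
    · exact Or.inl h
    · dsimp only at h
      split_ifs at h with h2
      · rcases ih h with h | ⟨i, hi, hf, h3, h4, h5⟩
        · rcases List.mem_append.1 h with h | h
          · exact Or.inl (List.mem_filter.1 h).1
          · obtain rfl := List.mem_singleton.1 h
            exact Or.inr ⟨j, by simp, h2.1, rfl, rfl, h2.2⟩
        · exact Or.inr ⟨i, List.mem_cons_of_mem _ hi, hf, h3, h4, h5.trans h2.2⟩
      · rcases ih h with h | ⟨i, hi, h⟩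
        · exact Or.inl h
        · exact Or.inr ⟨i, List.mem_cons_of_mem _ hi, h⟩

variable (N) in
/-- The first loop of round `n` of a TB query over the queue elements `Q`. -/
noncomputable def scanQueue (pt : Stop) (n : ℕ) (Q : List (QueueElem Trip))
    (x : WithTop ℤ × List (Label Trip)) : WithTop ℤ × List (Label Trip) :=
  Q.foldl (fun x s => N.scanExits pt n s s.exits x) x

theorem scanQueue_append (pt : Stop) (n : ℕ) (Q Q' : List (QueueElem Trip))
    (x : WithTop ℤ × List (Label Trip)) :
    N.scanQueue pt n (Q ++ Q') x = N.scanQueue pt n Q' (N.scanQueue pt n Q x) :=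
  List.foldl_append ..

theorem scanQueue_fst_le (pt : Stop) (n : ℕ) (Q : List (QueueElem Trip))
    (x : WithTop ℤ × List (Label Trip)) : (N.scanQueue pt n Q x).1 ≤ x.1 := by
  induction Q generalizing x with
  | nil => exact le_rfl
  | cons s Q ih => exact (ih _).trans (scanExits_fst_le ..)

theorem scanQueue_fst_le_of_mem {pt : Stop} {n : ℕ} {Q : List (QueueElem Trip)}
    (x : WithTop ℤ × List (Label Trip)) {s : QueueElem Trip} (hs : s ∈ Q)
    (hl : s.last ≤ N.len s.trip) {i : ℕ} (hi : s.entry < i) (hi' : i ≤ s.last)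
    (hf : N.foot (N.stopOf (s.trip, i)) pt) :
    (N.scanQueue pt n Q x).1 ≤
      ((N.arr s.trip i + N.walk (N.stopOf (s.trip, i)) pt : ℤ) : WithTop ℤ) := by
  obtain ⟨Q₁, Q₂, rfl⟩ := List.append_of_mem hs
  rw [scanQueue_append]
  refine (scanQueue_fst_le pt n Q₂ _).trans ?_
  refine scanExits_fst_le_of_mem ?_ _ (QueueElem.mem_exits.2 ⟨hi, hi'⟩) hf
  have h1 : s.exits.Pairwise (· < ·) := List.pairwise_lt_range'
  refine h1.imp_of_mem fun {a b} ha hb hab => ?_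
  rw [QueueElem.mem_exits] at ha hb
  exact N.arr_mono (by omega) hab.le (by omega)

theorem mem_scanQueue_snd {pt : Stop} {n : ℕ} {Q : List (QueueElem Trip)}
    {x : WithTop ℤ × List (Label Trip)} {J : Label Trip} (h : J ∈ (N.scanQueue pt n Q x).2) :
    J ∈ x.2 ∨ ∃ Q₁ s Q₂, Q = Q₁ ++ s :: Q₂ ∧ ∃ i, s.entry < i ∧ i ≤ s.last ∧
      N.foot (N.stopOf (s.trip, i)) pt ∧
      J.arrival = N.arr s.trip i + N.walk (N.stopOf (s.trip, i)) pt ∧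
      J.journey = s.journey i ∧ (J.arrival : WithTop ℤ) < (N.scanQueue pt n Q₁ x).1 := by
  induction Q generalizing x with
  | nil => exact Or.inl h
  | cons s Q ih =>
    rcases ih (x := N.scanExits pt n s s.exits x) h with h | ⟨Q₁, s', Q₂, rfl, h'⟩
    · refine (mem_scanExits_snd h).imp_right ?_
      rintro ⟨i, hi, h⟩
      rw [QueueElem.mem_exits] at hi
      exact ⟨[], s, Q, rfl, i, hi.1, hi.2, h⟩
    · exact Or.inr ⟨s :: Q₁, s', Q₂, rfl, h'⟩

section

variable {𝔗 : Set (Transfer Trip)} (O : N.ScanOrder 𝔗) (ps pt : Stop) (τ : ℤ)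

/-- The frontier at the start of round `k + 1` of a TB query. -/
noncomputable def tbFrontier (k : ℕ) : Frontier Trip :=
  ⟨(N.tbState O ps pt τ k).reached, (N.tbState O ps pt τ k).queue⟩

/-- The exits of a queue element that round `k + 1` of a TB query does not cut off. -/
noncomputable def tbExits (k : ℕ) (s : QueueElem Trip) : List ℕ :=
  s.exits.takeWhile fun i =>
    decide (((N.arr s.trip i : ℤ) : WithTop ℤ) < (N.tbState O ps pt τ (k + 1)).tmin)

/-- The requests that lead to the frontier `tbFrontier O ps pt τ k`. -/
noncomputable def tbRequests : ℕ → List (Request Trip)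
  | 0 => N.initialRequests O ps τ
  | k + 1 => N.requests O (fun _ => True) (tbExits O ps pt τ k) (tbFrontier O ps pt τ k).queue

theorem tbRequests_succ (k : ℕ) : tbRequests O ps pt τ (k + 1) =
    N.requests O (fun _ => True) (tbExits O ps pt τ k) (tbFrontier O ps pt τ k).queue := rfl

theorem tbState_succ_tmin (k : ℕ) : (N.tbState O ps pt τ (k + 1)).tmin =
    (N.scanQueue pt (k + 1) (tbFrontier O ps pt τ k).queue
      ((N.tbState O ps pt τ k).tmin, (N.tbState O ps pt τ k).front)).1 := rfl

theorem tbState_succ_front (k : ℕ) : (N.tbState O ps pt τ (k + 1)).front =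
    (N.scanQueue pt (k + 1) (tbFrontier O ps pt τ k).queue
      ((N.tbState O ps pt τ k).tmin, (N.tbState O ps pt τ k).front)).2 := rfl

theorem tbFrontier_succ (k : ℕ) : tbFrontier O ps pt τ (k + 1) =
    N.relax O (fun _ => True) (tbExits O ps pt τ k) (tbFrontier O ps pt τ k).queue
      (tbFrontier O ps pt τ k).reached := by
  show _ = N.relax O _ (fun s => tbExits O ps pt τ k s) _ _
  simp only [tbExits, tbFrontier, tbState, tbRound]
  congr! 3

theorem tmin_anti {j k : ℕ} (h : j ≤ k) :
    (N.tbState O ps pt τ k).tmin ≤ (N.tbState O ps pt τ j).tmin := by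
  induction k, h using Nat.le_induction with
  | base => exact le_rfl
  | succ k _ ih => exact (scanQueue_fst_le ..).trans ih

variable {O ps pt τ}

theorem isSearch_tb (h𝔗 : ∀ t ∈ 𝔗, N.IsCandidate t) :
    N.IsSearch (tbFrontier O ps pt τ) (tbRequests O ps pt τ) := by
  refine ⟨fun k => ?_, fun k r hr => ?_⟩
  · cases k with
    | zero => exact initialFrontier_eq O ps τ
    | succ k => rw [tbFrontier_succ, relax_eq]; rfl
  · cases k with
    | zero =>
      have := mem_initialRequests hr
      exact ⟨this.1, this.2.1⟩
    | succ k =>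
      rw [tbRequests_succ] at hr
      obtain ⟨s, -, i, -, hm, -⟩ := mem_requests.1 hr
      have := h𝔗 _ hm
      exact ⟨this.1.2.1.1, this.2.2.1⟩

theorem exists_of_mem_front {J : Label Trip} {n : ℕ} (h : J ∈ (N.tbState O ps pt τ n).front) :
    ∃ k Q₁ s Q₂, (tbFrontier O ps pt τ k).queue = Q₁ ++ s :: Q₂ ∧ ∃ i, s.entry < i ∧ i ≤ s.last ∧
      N.foot (N.stopOf (s.trip, i)) pt ∧
      J.arrival = N.arr s.trip i + N.walk (N.stopOf (s.trip, i)) pt ∧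
      J.journey = s.journey i ∧ (J.arrival : WithTop ℤ) < (N.scanQueue pt (k + 1) Q₁
        ((N.tbState O ps pt τ k).tmin, (N.tbState O ps pt τ k).front)).1 := by
  induction n with
  | zero => simp [tbState] at h
  | succ n ih =>
    rw [tbState_succ_front] at h
    rcases mem_scanQueue_snd h with h | ⟨Q₁, s, Q₂, h⟩
    · exact ih h
    · exact ⟨n, Q₁, s, Q₂, h⟩

theorem mem_tbExits {k : ℕ} {s : QueueElem Trip} (hl : s.last ≤ N.len s.trip) {x : ℕ}
    (hx : s.entry < x) (hx' : x ≤ s.last)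
    (ha : ((N.arr s.trip x : ℤ) : WithTop ℤ) < (N.tbState O ps pt τ (k + 1)).tmin) :
    x ∈ tbExits O ps pt τ k s := by
  refine mem_takeWhile_of_le List.pairwise_lt_range' (QueueElem.mem_exits.2 ⟨hx, hx'⟩) ?_
  intro y hy hyx
  have hy := QueueElem.mem_exits.1 hy
  have := N.arr_mono (T := s.trip) (i := y) (by omega) hyx (by omega)
  exact decide_eq_true ((WithTop.coe_le_coe.2 this).trans_lt ha)

/-! ### The journeys found by a TB query -/

variable (O ps pt τ) in
/-- A chain of queue elements of a TB query: `S (k + 1)` is the element that was enqueued when the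
transfer from `S k` at exit `b k` after the transfers `pre k` was relaxed. The elements of the
queue in front of `S k` are `P k`. -/
structure IsChain (n : ℕ) (S : ℕ → QueueElem Trip) (P : ℕ → List (QueueElem Trip)) (b : ℕ → ℕ)
    (pre : ℕ → List (StopEvent Trip)) : Prop where
  queue : ∀ k ≤ n, ∃ l, (tbFrontier O ps pt τ k).queue = P k ++ S k :: l
  parents_zero : (S 0).parents = []
  parents : ∀ k < n, (S (k + 1)).parents = (S k).journey (b k)
  transfers : ∀ k < n, ∃ post,
    O.transfers ((S k).trip, b k) = pre k ++ ((S (k + 1)).trip, (S (k + 1)).entry) :: post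
  exits : ∀ k < n, ∃ x₁ x₂, tbExits O ps pt τ k (S k) = x₁ ++ b k :: x₂ ∧
    (N.enqueueAll (N.requestsBefore O (fun _ => True) (tbExits O ps pt τ k) (P k) (S k) x₁ (b k)
      (pre k)) (N.roundStart (tbFrontier O ps pt τ) (k + 1))).queue = P (k + 1)

theorem exists_isChain (h𝔗 : ∀ t ∈ 𝔗, N.IsCandidate t) (n : ℕ) {Q₁ Q₂ : List (QueueElem Trip)}
    {s : QueueElem Trip} (hs : (tbFrontier O ps pt τ n).queue = Q₁ ++ s :: Q₂) (i : ℕ) :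
    ∃ S P b pre, IsChain O ps pt τ n S P b pre ∧ S n = s ∧ P n = Q₁ ∧ b n = i := by
  have hS := isSearch_tb (O := O) (ps := ps) (pt := pt) (τ := τ) h𝔗
  induction n generalizing Q₁ s Q₂ i with
  | zero =>
    refine ⟨fun _ => s, fun _ => Q₁, fun _ => i, fun _ => [], ?_, rfl, rfl, rfl⟩
    refine ⟨fun k hk => ?_, ?_, by simp, by simp, by simp⟩
    · obtain rfl : k = 0 := by omega
      exact ⟨_, hs⟩
    · obtain ⟨r, hr, -, -, hp⟩ := hS.exists_request (k := 0) (s := s) (by simp [hs])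
      rw [hp, (mem_initialRequests hr).2.2.2.2]
  | succ n ih =>
    obtain ⟨R₁, r, R₂, h1, h2, -, h3⟩ := hS.queue_split hs
    rw [tbRequests_succ] at h1
    obtain ⟨Q₁', s', Q₂', x₁, j, x₂, t₁, t₂, h4, h5, h6, h7, h8⟩ := exists_of_requests_eq h1
    obtain ⟨S, P, b, pre, hC, rfl, rfl, rfl⟩ := ih h4 j
    refine ⟨fun k => if k ≤ n then S k else s, fun k => if k ≤ n then P k else Q₁,
      fun k => if k ≤ n then b k else i, fun k => if k < n then pre k else t₁, ?_,
      by simp, by simp, by simp⟩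
    have hcase : ∀ k < n + 1, k < n ∨ k = n := fun k hk => by omega
    refine ⟨fun k hk => ?_, by simpa using hC.parents_zero, fun k hk => ?_,
      fun k hk => ?_, fun k hk => ?_⟩
    · by_cases hkn : k ≤ n
      · simpa [hkn] using hC.queue k hkn
      · obtain rfl : k = n + 1 := by omega
        exact ⟨Q₂, by simpa using hs⟩
    · rcases hcase k hk with hk | rfl
      · simpa [hk, hk.le, Nat.succ_le_of_lt hk] using hC.parents k hk
      · simp [h3, h7]
    · rcases hcase k hk with hk | rfl
      · simpa [hk, hk.le, Nat.succ_le_of_lt hk] using hC.transfers k hk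
      · exact ⟨t₂, by simpa [h3] using h6⟩
    · rcases hcase k hk with hk | rfl
      · simpa [hk, hk.le, Nat.succ_le_of_lt hk] using hC.exits k hk
      · exact ⟨x₁, x₂, by simpa using h5, by simp [← h2, h8]⟩

end

end Network

end TREX

namespace TREX

/-! ### Optimality of the journeys found by a TB query -/

theorem journeyTransfers_append_pair {Trip : Type*} (l : List (Leg Trip)) (x y : Leg Trip) :
    journeyTransfers (l ++ [x] ++ [y]) =
      journeyTransfers (l ++ [x]) ++ [((x.trip, x.exit), (y.trip, y.entry))] := by
  induction l with
  | nil => rfl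
  | cons z l ih =>
    cases l with
    | nil => rfl
    | cons w l =>
      simp only [List.cons_append, journeyTransfers, List.cons.injEq, true_and] at ih ⊢
      exact ih

namespace Network

variable {Stop Trip Line : Type*} {N : Network Stop Trip Line} {𝔗 : Set (Transfer Trip)}

/-- Trips `T 0, ..., T n`, where `T k` is entered at `a k` and left at `b k`, that lead from `ps` to
`pt` by means of transfers of `𝔗` and arrive at `A`, such that no journey that shares the legs
before `T k` saves a trip, and such that, among the journeys with equally many trips, those that
deviate from this one in the ride on `T k` or in the transfer after it by a choice that is examined
earlier arrive after `A`. The transfers from `T k` at `b k` that are examined before the one that is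
used are `pre k`. -/
structure IsOptimalRoute (O : N.ScanOrder 𝔗) (ps pt : Stop) (A : ℤ) (n : ℕ) (T : ℕ → Trip)
    (a b : ℕ → ℕ) (pre : ℕ → List (StopEvent Trip)) : Prop where
  entry_pos : ∀ k ≤ n, 1 ≤ a k
  entry_lt : ∀ k ≤ n, a k < b k
  exit_le : ∀ k ≤ n, b k ≤ N.len (T k)
  transfers : ∀ k < n, ∃ post,
    O.transfers (T k, b k) = pre k ++ (T (k + 1), a (k + 1)) :: post
  start : N.foot ps (N.stopOf (T 0, a 0))
  reaches : ∀ k ≤ n, N.Reaches pt A (n - k) (N.stopOf (T k, b k)) (N.arr (T k) (b k))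
  finish : N.foot (N.stopOf (T n, b n)) pt
  not_boards : ∀ k ≤ n, ∀ r, k + 1 + r ≤ n → ¬ N.Boards pt A r (T k) (a k)
  not_boards_of_before : ∀ k < n, ∀ x e, a k < x →
    (x < b k ∧ ((T k, x), e) ∈ 𝔗 ∨ x = b k ∧ e ∈ pre k) →
    ¬ N.Boards pt A (n - (k + 1)) e.1 e.2

section

variable {O : N.ScanOrder 𝔗} {ps pt : Stop} {τ : ℤ} {n : ℕ} {A : ℤ}

theorem exists_mem_tbFrontier_zero [Finite Trip] (h𝔗 : N.IsPrecomputed 𝔗) {W : Trip} {w : ℕ}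
    (hw : 1 ≤ w) (hl : w < N.len W) (hf : N.foot ps (N.stopOf (W, w)))
    (hd : τ + N.walk ps (N.stopOf (W, w)) ≤ N.dep W w) :
    ∃ s ∈ (tbFrontier O ps pt τ 0).queue, N.PrecedesEq s.trip W ∧ s.entry ≤ w := by
  have hS := isSearch_tb (O := O) (ps := ps) (pt := pt) (τ := τ) fun t ht => h𝔗.isCandidate ht
  obtain ⟨r, hr, h1, h2⟩ := exists_mem_initialRequests O hw hl hf hd
  obtain ⟨s, hs, h3, h4⟩ := hS.exists_of_mem (k := 0) (R' := tbRequests O ps pt τ 0) hr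
    (by rw [h2, h1.len_eq]; exact hl)
  rw [← hS.eq] at hs
  exact ⟨s, hs.resolve_right (by simp), h3.trans h1, h2 ▸ h4⟩

/-- `IsSearch.not_boards_of_prefix` for a TB query. -/
theorem not_boards_of_prefix_tbFrontier [Finite Trip] (h𝔗 : N.IsPrecomputed 𝔗)
    (hwalk : N.foot ps pt → A < τ + N.walk ps pt) {M : ℕ}
    (fewer : ∀ k r, k + 1 + r < M → ∀ s ∈ (tbFrontier O ps pt τ k).queue,
      ¬ N.Boards pt A r s.trip s.entry)
    {P : ℕ → List (QueueElem Trip)} (hP : ∀ k < M, P k <+: (tbFrontier O ps pt τ k).queue)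
    (next : ∀ k, k + 1 < M → ∀ s ∈ P k, ∀ x e, s.entry < x → x ≤ s.last →
      N.arr s.trip x ≤ A → ((s.trip, x), e) ∈ 𝔗 →
      ∃ s', (s' ∈ P (k + 1) ∨ ∃ j < k + 1, s' ∈ (tbFrontier O ps pt τ j).queue) ∧
        N.PrecedesEq s'.trip e.1 ∧ s'.entry ≤ e.2)
    (final : ∀ k, k + 1 = M → ∀ s ∈ P k, ∀ x, s.entry < x → x ≤ s.last →
      N.foot (N.stopOf (s.trip, x)) pt → A < N.arr s.trip x + N.walk (N.stopOf (s.trip, x)) pt) :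
    ∀ k r, k + 1 + r = M → ∀ s ∈ P k, ¬ N.Boards pt A r s.trip s.entry := by
  have hS := isSearch_tb (O := O) (ps := ps) (pt := pt) (τ := τ) fun t ht => h𝔗.isCandidate ht
  refine hS.not_boards_of_prefix (fun t ht => (h𝔗.isCandidate ht).1) h𝔗.isComplete ?_
    (fun W w => exists_mem_tbFrontier_zero h𝔗) ?_ hwalk fewer hP ?_ final
  · intro r hr
    have := mem_initialRequests hr
    exact ⟨this.2.2.1, this.2.2.2.1⟩
  · intro k r hr
    rw [tbRequests_succ] at hr
    obtain ⟨s, hs, x, hx, hm, -⟩ := mem_requests.1 hr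
    exact ⟨s, hs, x, (QueueElem.mem_exits.1 ((List.takeWhile_sublist _).subset hx)).1, hm⟩
  · simpa only [Nat.lt_succ_iff] using next

/-- No element of a TB query allows a journey that arrives by `A` with so few trips that it would
have been found while the arrival time at the target was still later than `A`. -/
theorem not_boards_of_mem_tbFrontier [Finite Trip] (h𝔗 : N.IsPrecomputed 𝔗)
    (hwalk : N.foot ps pt → A < τ + N.walk ps pt)
    (hA : (A : WithTop ℤ) < (N.tbState O ps pt τ n).tmin) {k r : ℕ} (hk : k + 1 + r ≤ n)
    {s : QueueElem Trip} (hs : s ∈ (tbFrontier O ps pt τ k).queue) :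
    ¬ N.Boards pt A r s.trip s.entry := by
  have hS := isSearch_tb (O := O) (ps := ps) (pt := pt) (τ := τ) fun t ht => h𝔗.isCandidate ht
  induction hM : k + 1 + r using Nat.strong_induction_on generalizing k r s with
  | _ M ih =>
  subst hM
  refine not_boards_of_prefix_tbFrontier h𝔗 hwalk
    (fun k' r' h s' hs' => ih _ h (by omega) hs' rfl)
    (P := fun k => (tbFrontier O ps pt τ k).queue) (fun _ _ => List.prefix_rfl) ?_ ?_ k r rfl s hs
  · intro k' hk' s' hs' x e hx hxl ha hm
    have hmem : (e, s'.journey x) ∈ tbRequests O ps pt τ (k' + 1) := by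
      rw [tbRequests_succ, mem_requests]
      refine ⟨s', hs', x, mem_tbExits (hS.last_le hs') hx hxl ?_, hm, trivial, rfl⟩
      exact ((WithTop.coe_le_coe.2 ha).trans_lt hA).trans_le (tmin_anti O ps pt τ (by omega))
    have := hS.exists_of_mem (k := k' + 1) hmem (h𝔗.isCandidate hm).2.2.1
    rwa [← hS.eq] at this
  · intro k' hk' s' hs' x hx hxl hf
    have h1 := scanQueue_fst_le_of_mem (n := k' + 1) ((N.tbState O ps pt τ k').tmin,
      (N.tbState O ps pt τ k').front) hs' (hS.last_le hs') hx hxl hf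
    rw [← tbState_succ_tmin] at h1
    exact WithTop.coe_lt_coe.1
      ((hA.trans_le (tmin_anti O ps pt τ (show k' + 1 ≤ n by omega))).trans_le h1)

theorem mem_of_tbExits_eq {k : ℕ} {s : QueueElem Trip} {x₁ x₂ : List ℕ} {i : ℕ}
    (h : tbExits O ps pt τ k s = x₁ ++ i :: x₂) :
    (s.entry < i ∧ i ≤ s.last) ∧ ∀ x, s.entry < x → x < i → x ∈ x₁ := by
  obtain ⟨l, hl⟩ : tbExits O ps pt τ k s <+: s.exits := List.takeWhile_prefix _
  rw [h, List.append_assoc, List.cons_append] at hl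
  refine ⟨QueueElem.mem_exits.1 (by simp [← hl]), fun x hx hxi => ?_⟩
  exact (mem_left_of_range'_eq hl.symm x).2 ⟨hx, hxi⟩

theorem IsChain.journeyTransfers {S : ℕ → QueueElem Trip} {P : ℕ → List (QueueElem Trip)}
    {b : ℕ → ℕ} {pre : ℕ → List (StopEvent Trip)} (hC : IsChain O ps pt τ n S P b pre) {k : ℕ}
    (hk : k ≤ n) (i : ℕ) {t : Transfer Trip} (ht : t ∈ journeyTransfers ((S k).journey i)) :
    ∃ j < k, t = (((S j).trip, b j), ((S (j + 1)).trip, (S (j + 1)).entry)) := by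
  induction k generalizing i with
  | zero =>
    rw [QueueElem.journey, hC.parents_zero] at ht
    simp [TREX.journeyTransfers] at ht
  | succ k ih =>
    rw [QueueElem.journey, hC.parents k hk, QueueElem.journey, journeyTransfers_append_pair,
      List.mem_append, List.mem_singleton] at ht
    rcases ht with ht | ht
    · obtain ⟨j, hj, h⟩ := ih (by omega) (b k) ht
      exact ⟨j, by omega, h⟩
    · exact ⟨k, by omega, ht⟩

/-- The journey of a label that enters the Pareto front is optimal, and the first such journey in
scan order. -/
theorem exists_isOptimalRoute [Finite Trip] (h𝔗 : N.IsPrecomputed 𝔗) {J : Label Trip} {m : ℕ}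
    (hJ : J ∈ (N.tbState O ps pt τ m).front)
    (hwalk : N.foot ps pt → J.arrival < τ + N.walk ps pt) :
    ∃ n T a b pre, N.IsOptimalRoute O ps pt J.arrival n T a b pre ∧
      ∀ t ∈ TREX.journeyTransfers J.journey, ∃ k < n, t = ((T k, b k), (T (k + 1), a (k + 1))) := by
  have hS := isSearch_tb (O := O) (ps := ps) (pt := pt) (τ := τ) fun t ht => h𝔗.isCandidate ht
  obtain ⟨n, Q₁, s, Q₂, hQ, i, hi, hil, hf, harr, hjour, hlt⟩ := exists_of_mem_front hJ
  obtain ⟨S, P, b, pre, hC, rfl, rfl, rfl⟩ :=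
    exists_isChain (fun t ht => h𝔗.isCandidate ht) n hQ i
  have hA : (J.arrival : WithTop ℤ) < (N.tbState O ps pt τ n).tmin :=
    hlt.trans_le (scanQueue_fst_le ..)
  have fewer : ∀ k r, k + 1 + r < n + 1 → ∀ s ∈ (tbFrontier O ps pt τ k).queue,
      ¬ N.Boards pt J.arrival r s.trip s.entry := fun k r h s hs =>
    not_boards_of_mem_tbFrontier h𝔗 hwalk hA (by omega) hs
  have hmem : ∀ k ≤ n, S k ∈ (tbFrontier O ps pt τ k).queue := fun k hk => by
    obtain ⟨l, hl⟩ := hC.queue k hk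
    simp [hl]
  have hexit : ∀ k ≤ n, (S k).entry < b k ∧ b k ≤ (S k).last := fun k hk => by
    rcases hk.lt_or_eq with hk | rfl
    · obtain ⟨x₁, x₂, h1, -⟩ := hC.exits k hk
      exact (mem_of_tbExits_eq h1).1
    · exact ⟨hi, hil⟩
  have hexit_le : ∀ k ≤ n, b k ≤ N.len (S k).trip := fun k hk =>
    (hexit k hk).2.trans (hS.last_le (hmem k hk))
  have htr : ∀ k < n, N.IsTransfer (((S k).trip, b k), ((S (k + 1)).trip, (S (k + 1)).entry)) := by
    intro k hk
    obtain ⟨post, hpost⟩ := hC.transfers k hk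
    exact (h𝔗.isCandidate ((O.mem_transfers _ _).1 (by simp [hpost]))).1
  -- Elements in front of those of the journey would have improved the arrival time before it.
  have ahead : ∀ k r, k + 1 + r = n + 1 → ∀ s ∈ P k,
      ¬ N.Boards pt J.arrival r s.trip s.entry := by
    refine not_boards_of_prefix_tbFrontier h𝔗 hwalk fewer ?_ ?_ ?_
    · intro k hk
      obtain ⟨l, hl⟩ := hC.queue k (by omega)
      exact ⟨_, hl.symm⟩
    · intro k hk s hs x e hx hxl ha hm
      obtain ⟨x₁, x₂, -, h1⟩ := hC.exits k (by omega)
      have hsF : s ∈ (tbFrontier O ps pt τ k).queue := by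
        obtain ⟨l, hl⟩ := hC.queue k (by omega)
        simp [hl, hs]
      rw [← h1]
      refine hS.exists_of_mem (r := (e, s.journey x)) (mem_requestsBefore.2 (Or.inl
        ⟨s, hs, x, mem_tbExits (hS.last_le hsF) hx hxl ?_, hm, trivial, rfl⟩))
        (h𝔗.isCandidate hm).2.2.1
      exact ((WithTop.coe_le_coe.2 ha).trans_lt hA).trans_le (tmin_anti O ps pt τ (by omega))
    · intro k hk s hs x hx hxl hfx
      obtain rfl : k = n := by omega
      have hsF : s ∈ (tbFrontier O ps pt τ k).queue := by simp [hQ, hs]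
      exact WithTop.coe_lt_coe.1
        (hlt.trans_le (scanQueue_fst_le_of_mem _ hs (hS.last_le hsF) hx hxl hfx))
  have hreach : ∀ k ≤ n, N.Reaches pt J.arrival (n - k) (N.stopOf ((S k).trip, b k))
      (N.arr (S k).trip (b k)) := by
    intro k hk
    induction hk using Nat.decreasingInduction with
    | self => exact Reaches.of_walk hf harr.ge
    | of_succ k hk ih =>
      rw [show n - k = n - (k + 1) + 1 by omega]
      obtain ⟨-, h1, h2, h3⟩ := htr k hk
      exact Reaches.of_boards h1.1 h2 h3
        ⟨b (k + 1), (hexit (k + 1) hk).1, hexit_le (k + 1) hk, ih⟩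
  refine ⟨n, fun k => (S k).trip, fun k => (S k).entry, b, pre,
    ⟨fun k hk => hS.entry_pos (hmem k hk), fun k hk => (hexit k hk).1, hexit_le, hC.transfers,
      ?_, hreach, hf, fun k hk r hr => fewer k r (by omega) _ (hmem k hk), ?_⟩,
    fun t ht => hC.journeyTransfers le_rfl _ (hjour ▸ ht)⟩
  · obtain ⟨r, hr, h1, h2, -⟩ := hS.exists_request (hmem 0 (Nat.zero_le n))
    rw [h1, h2]
    exact (mem_initialRequests hr).2.2.1
  · intro k hk x e hx hxe hb
    obtain ⟨x₁, x₂, h1, h2⟩ := hC.exits k hk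
    have hreq : (e, (S k).journey x) ∈ N.requestsBefore O (fun _ => True)
        (tbExits O ps pt τ k) (P k) (S k) x₁ (b k) (pre k) := by
      rw [mem_requestsBefore]
      rcases hxe with ⟨hxb, hm⟩ | ⟨rfl, hm⟩
      · exact Or.inr (Or.inl ⟨x, (mem_of_tbExits_eq h1).2 x hx hxb, hm, trivial, rfl⟩)
      · exact Or.inr (Or.inr ⟨hm, trivial, rfl⟩)
    obtain ⟨s', hs', h3, h4⟩ := hS.exists_of_mem (k := k + 1) hreq hb.lt_len
    have hb' := hb.mono h3 h4
    rw [h2] at hs'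
    rcases hs' with hs' | ⟨j, hj, hs'⟩
    · exact ahead (k + 1) (n - (k + 1)) (by omega) s' hs' hb'
    · exact fewer j (n - (k + 1)) (by omega) s' hs' hb'

end

end Network

end TREX

namespace TREX

namespace Network

variable {Stop Trip Line : Type*} {N : Network Stop Trip Line}

/-! ### The Event-TB searches of the customization -/

theorem exists_request_of_mem_enqueueAll {R : List (Request Trip)} {f : Frontier Trip}
    (hf : f.queue = []) {s : QueueElem Trip} (hs : s ∈ (N.enqueueAll R f).queue) :
    ∃ r ∈ R, s.trip = r.1.1 ∧ s.entry = r.1.2 ∧ s.parents = r.2 := by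
  obtain ⟨l₁, l₂, hs⟩ := List.append_of_mem hs
  obtain ⟨R₁, r, R₂, h1, -, -, rfl⟩ := enqueueAll_queue_split hf hs
  exact ⟨r, by simp [h1], rfl, rfl, rfl⟩

theorem entry_cons_exits (s : QueueElem Trip) :
    s.entry :: s.exits = List.range' s.entry (s.last - s.entry + 1) :=
  List.range'_succ.symm

theorem firstOBE_eq_some {C : Set N.Vertex} {s : QueueElem Trip} {i : ℕ} (hi : s.entry ≤ i)
    (hl : i ≤ s.last) (h : N.IsOBE C (s.trip, i))
    (hfirst : ∀ x, s.entry ≤ x → x < i → ¬ N.IsOBE C (s.trip, x)) :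
    N.firstOBE C s = some i := by
  rw [firstOBE, entry_cons_exits, List.find?_eq_some_iff_append]
  have hmem : i ∈ List.range' s.entry (s.last - s.entry + 1) := by
    rw [List.mem_range'_1]
    omega
  obtain ⟨l₁, l₂, hl⟩ := List.append_of_mem hmem
  refine ⟨by simpa using h, l₁, l₂, hl, fun x hx => ?_⟩
  have := (mem_left_of_range'_eq hl x).1 hx
  simpa using hfirst x this.1 this.2

theorem firstOBE_spec {C : Set N.Vertex} {s : QueueElem Trip} {i : ℕ}
    (h : N.firstOBE C s = some i) : s.entry ≤ i ∧ N.IsOBE C (s.trip, i) := by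
  rw [firstOBE] at h
  refine ⟨?_, by simpa using List.find?_some h⟩
  have := List.mem_of_find?_eq_some h
  rw [entry_cons_exits, List.mem_range'_1] at this
  exact this.1

theorem cutOff_entry (C : Set N.Vertex) (s : QueueElem Trip) :
    (N.cutOff C s).entry = s.entry := by
  unfold cutOff
  split <;> rfl

theorem le_cutOff_last {C : Set N.Vertex} {s : QueueElem Trip} {i : ℕ} (hl : i ≤ s.last)
    (hfirst : ∀ x, s.entry ≤ x → x < i → ¬ N.IsOBE C (s.trip, x)) :
    i ≤ (N.cutOff C s).last := by
  unfold cutOff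
  split
  · rename_i j hj
    obtain ⟨h1, h2⟩ := firstOBE_spec hj
    exact not_lt.1 fun h3 => hfirst j h1 h3 h2
  · exact hl

/-- The outgoing border events that have been collected lie on the collecting queue elements. -/
theorem mem_foldl_collectOBE {C : Set N.Vertex} {Q : List (QueueElem Trip)}
    {found : List (StopEvent Trip × List (Leg Trip))} {y : StopEvent Trip × List (Leg Trip)}
    (h : y ∈ Q.foldl (N.collectOBE C) found) :
    y ∈ found ∨ ∃ s ∈ Q, y.1.1 = s.trip ∧ s.entry ≤ y.1.2 := by
  induction Q generalizing found with
  | nil => exact Or.inl h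
  | cons s Q ih =>
    rcases ih h with h | ⟨s', hs', h⟩
    · unfold collectOBE at h
      split at h
      · rename_i i hi
        split_ifs at h
        · exact Or.inl h
        · rcases List.mem_append.1 h with h | h
          · exact Or.inl h
          · obtain rfl := List.mem_singleton.1 h
            exact Or.inr ⟨s, by simp, rfl, (firstOBE_spec hi).1⟩
      · exact Or.inl h
    · exact Or.inr ⟨s', List.mem_cons_of_mem _ hs', h⟩

theorem subset_foldl_collectOBE (C : Set N.Vertex) (Q : List (QueueElem Trip))
    (found : List (StopEvent Trip × List (Leg Trip))) :
    found ⊆ Q.foldl (N.collectOBE C) found := by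
  induction Q generalizing found with
  | nil => exact List.Subset.refl _
  | cons s Q ih =>
    refine List.Subset.trans ?_ (ih _)
    unfold collectOBE
    split
    · split_ifs
      · exact List.Subset.refl _
      · exact List.subset_append_left _ _
    · exact List.Subset.refl _

section

variable {𝔗 : Set (Transfer Trip)} (O : N.ScanOrder 𝔗) (C : Set N.Vertex) (ℓ : ℕ)
  (rank : Transfer Trip → ℕ) (e : StopEvent Trip)

/-- The frontier at the start of round `k + 1` of an Event-TB search. -/
noncomputable def eventFrontier (k : ℕ) : Frontier Trip :=
  ⟨(N.eventState O C ℓ rank e k).reached, (N.eventState O C ℓ rank e k).queue⟩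

/-- The requests that lead to the frontier `eventFrontier O C ℓ rank e k`. -/
noncomputable def eventRequests : ℕ → List (Request Trip)
  | 0 => [(e, [])]
  | k + 1 => N.requests O (fun t => ¬ rank t < ℓ) (fun s => (N.cutOff C s).exits)
      (eventFrontier O C ℓ rank e k).queue

theorem eventRequests_succ (k : ℕ) : eventRequests O C ℓ rank e (k + 1) =
    N.requests O (fun t => ¬ rank t < ℓ) (fun s => (N.cutOff C s).exits)
      (eventFrontier O C ℓ rank e k).queue := rfl

theorem eventFrontier_succ (k : ℕ) : eventFrontier O C ℓ rank e (k + 1) =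
    N.relax O (fun t => ¬ rank t < ℓ) (fun s => (N.cutOff C s).exits)
      (eventFrontier O C ℓ rank e k).queue (eventFrontier O C ℓ rank e k).reached := rfl

theorem eventState_succ_found (k : ℕ) : (N.eventState O C ℓ rank e (k + 1)).found =
    (eventFrontier O C ℓ rank e k).queue.foldl (N.collectOBE C)
      (N.eventState O C ℓ rank e k).found := rfl

variable {O C ℓ rank e}

theorem isSearch_event (h𝔗 : ∀ t ∈ 𝔗, N.IsCandidate t) (he : 1 ≤ e.2) (hl : e.2 < N.len e.1) :
    N.IsSearch (eventFrontier O C ℓ rank e) (eventRequests O C ℓ rank e) := by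
  refine ⟨fun k => ?_, fun k r hr => ?_⟩
  · cases k with
    | zero => rfl
    | succ k => rw [eventFrontier_succ, relax_eq]; rfl
  · cases k with
    | zero =>
      obtain rfl := List.mem_singleton.1 hr
      exact ⟨he, hl⟩
    | succ k =>
      rw [eventRequests_succ] at hr
      obtain ⟨s, -, i, -, hm, -⟩ := mem_requests.1 hr
      have := h𝔗 _ hm
      exact ⟨this.1.2.1.1, this.2.2.1⟩

theorem exists_of_mem_found {k : ℕ} {y : StopEvent Trip × List (Leg Trip)}
    (h : y ∈ (N.eventState O C ℓ rank e k).found) :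
    ∃ j < k, ∃ s ∈ (eventFrontier O C ℓ rank e j).queue, y.1.1 = s.trip ∧ s.entry ≤ y.1.2 := by
  induction k with
  | zero => simp [eventState] at h
  | succ k ih =>
    rw [eventState_succ_found] at h
    rcases mem_foldl_collectOBE h with h | h
    · obtain ⟨j, hj, h⟩ := ih h
      exact ⟨j, by omega, h⟩
    · exact ⟨k, by omega, h⟩

variable {ps pt : Stop} {A : ℤ} {n : ℕ} {T : ℕ → Trip} {a b : ℕ → ℕ}
  {pre : ℕ → List (StopEvent Trip)}

/-- An Event-TB search from an event of leg `m` of an optimal route does not find journeys that save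
a trip. -/
theorem IsOptimalRoute.not_boards_of_mem_eventFrontier (h𝔗 : ∀ t ∈ 𝔗, N.IsCandidate t)
    (hT : N.IsOptimalRoute O ps pt A n T a b pre) {m i : ℕ} (hm : m ≤ n) (hi : a m ≤ i)
    (hib : i < b m) {d r : ℕ} (hd : m + d + 1 + r ≤ n) {s : QueueElem Trip}
    (hs : s ∈ (eventFrontier O C ℓ rank (T m, i) d).queue) :
    ¬ N.Boards pt A r s.trip s.entry := by
  have hS := isSearch_event (O := O) (C := C) (ℓ := ℓ) (rank := rank) (e := (T m, i)) h𝔗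
    ((hT.entry_pos m hm).trans hi) (hib.trans_le (hT.exit_le m hm))
  induction d generalizing r s with
  | zero =>
    obtain ⟨q, hq, h1, h2, -⟩ := hS.exists_request hs
    obtain rfl := List.mem_singleton.1 hq
    rw [h1, h2]
    exact fun hb => hT.not_boards m hm r hd (hb.mono (PrecedesEq.refl _) hi)
  | succ d ih =>
    obtain ⟨q, hq, h1, h2, -⟩ := hS.exists_request hs
    rw [eventRequests_succ] at hq
    obtain ⟨s', hs', x, hx, hmem, -⟩ := mem_requests.1 hq
    have hx := (QueueElem.mem_exits.1 hx).1
    rw [cutOff_entry] at hx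
    rw [h1, h2]
    exact fun hb => ih (r := r + 1) (by omega) hs' (Boards.of_transfer hx (h𝔗 _ hmem).1 hb)

/-- The induction step: the Event-TB search follows an optimal route over one more transfer. -/
theorem IsOptimalRoute.exists_eventFrontier (h𝔗 : ∀ t ∈ 𝔗, N.IsCandidate t)
    (hT : N.IsOptimalRoute O ps pt A n T a b pre) {m i : ℕ} (hm : m ≤ n) (hi : a m ≤ i)
    (hib : i < b m) (d : ℕ) (hd : m + d ≤ n)
    (hrank : ∀ k, m ≤ k → k < m + d → ℓ ≤ rank ((T k, b k), (T (k + 1), a (k + 1))))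
    (hobe : ∀ k, m ≤ k → k < m + d → ∀ x, a k ≤ x → (k = m → i ≤ x) → x < b k →
      ¬ N.IsOBE C (T k, x)) :
    ∃ l₁ s l₂, (eventFrontier O C ℓ rank (T m, i) d).queue = l₁ ++ s :: l₂ ∧
      s.trip = T (m + d) ∧ a (m + d) ≤ s.entry ∧ (d = 0 → s.entry = i) ∧
      (d ≠ 0 → s.entry = a (m + d)) ∧
      s.entry < b (m + d) ∧ b (m + d) ≤ s.last ∧
      (∀ s' ∈ l₁, ¬ N.Boards pt A (n - (m + d)) s'.trip s'.entry) ∧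
      ∀ k, m ≤ k → k < m + d → ∀ x,
        ((T k, b k), (T (k + 1), a (k + 1))) ∈ journeyTransfers (s.journey x) := by
  have hS := isSearch_event (O := O) (C := C) (ℓ := ℓ) (rank := rank) (e := (T m, i)) h𝔗
    ((hT.entry_pos m hm).trans hi) (hib.trans_le (hT.exit_le m hm))
  induction d with
  | zero =>
    refine ⟨[], ⟨T m, i, N.len (T m), []⟩, [], ?_, rfl, hi, fun _ => rfl, by simp, hib,
      hT.exit_le m hm, by simp, fun k h1 h2 => by omega⟩
    have h1 := hT.exit_le m hm
    show (N.enqueue (T m) i [] N.emptyFrontier).queue = _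
    unfold enqueue
    rw [if_neg (by simp only [emptyFrontier]; omega)]
    simp [emptyFrontier]
  | succ d ih =>
    obtain ⟨l₁, s, l₂, hq, hst, has, hsi, -, hsb, hbl, hl₁, hjt⟩ := ih (by omega)
      (fun k h1 h2 => hrank k h1 (by omega)) (fun k h1 h2 => hobe k h1 (by omega))
    rw [← Nat.add_assoc] at hd hrank hobe ⊢
    generalize hk : m + d = k at *
    have hkn : k < n := hd
    have hcut : b k ≤ (N.cutOff C s).last := by
      refine le_cutOff_last hbl fun x hx hxb => hst ▸ hobe k (by omega) (by omega) x
        (has.trans hx) (fun hkm => ?_) hxb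
      exact hsi (by omega) ▸ hx
    have hmem : b k ∈ (N.cutOff C s).exits :=
      QueueElem.mem_exits.2 ⟨by rwa [cutOff_entry], hcut⟩
    obtain ⟨x₁, x₂, hx⟩ := List.append_of_mem hmem
    have hx₁ : ∀ x ∈ x₁, s.entry < x ∧ x < b k := fun x hx' => by
      have := (mem_left_of_range'_eq hx x).1 hx'
      rw [cutOff_entry] at this
      exact this
    obtain ⟨post, hpost⟩ := hT.transfers k hkn
    obtain ⟨R₂, hR⟩ := exists_requests_eq (O := O) (allowed := fun t => ¬ rank t < ℓ)
      (exits := fun s => (N.cutOff C s).exits) (Q₁ := l₁) (Q₂ := l₂) (s := s) hx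
      (hst ▸ hpost) (by rw [hst]; exact not_lt.2 (hrank k (by omega) (by omega)))
    rw [← hq, ← eventRequests_succ] at hR
    set R₁ := N.requestsBefore O (fun t => ¬ rank t < ℓ) (fun s => (N.cutOff C s).exits) l₁ s x₁
      (b k) (pre k) with hR₁
    set F := eventFrontier O C ℓ rank (T m, i) with hF
    set f := N.enqueueAll R₁ (N.roundStart F (d + 1)) with hf
    -- What is enqueued in this round before the next leg of the route deviates from the route by an
    -- earlier choice, so it does not lead to the target in time.
    have hnew : ∀ s' ∈ f.queue, ¬ N.Boards pt A (n - (k + 1)) s'.trip s'.entry := by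
      intro s' hs' hb
      obtain ⟨r, hr, h1, h2, -⟩ := exists_request_of_mem_enqueueAll
        (IsSearch.roundStart_queue (d + 1)) hs'
      rw [h1, h2] at hb
      rcases mem_requestsBefore.1 hr with ⟨p, hp, y, hy, hm', -⟩ | ⟨y, hy, hm', -⟩ | ⟨hm', -⟩
      · have hy := (QueueElem.mem_exits.1 hy).1
        rw [cutOff_entry] at hy
        have := Boards.of_transfer hy (h𝔗 _ hm').1 hb
        rw [show n - (k + 1) + 1 = n - k by omega] at this
        exact hl₁ p hp this
      · have := hx₁ y hy
        exact hT.not_boards_of_before k hkn y r.1 (has.trans_lt this.1)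
          (Or.inl ⟨this.2, hst ▸ hm'⟩) hb
      · exact hT.not_boards_of_before k hkn (b k) r.1 (has.trans_lt hsb) (Or.inr ⟨rfl, hm'⟩) hb
    -- Hence the next leg is neither pruned nor cut off before its exit.
    have hreached : b (k + 1) < f.reached (T (k + 1)) := by
      by_contra hcon
      have hlen := hT.exit_le (k + 1) hkn
      have hrb := hS.isReachedBy (d + 1) R₁
      rw [← hf] at hrb
      obtain ⟨s', hs', h1, h2⟩ := hrb.exists_mem (T (k + 1)) (by omega)
      have hb : N.Boards pt A (n - (k + 1)) s'.trip s'.entry :=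
        Boards.of_precedesEq h1 (by omega) hlen (hT.reaches (k + 1) hkn)
      rcases hs' with ⟨j, hj, hs'⟩ | hs'
      · exact hT.not_boards_of_mem_eventFrontier h𝔗 hm hi hib (by omega) hs' hb
      · exact hnew s' hs' hb
    have hab := hT.entry_lt (k + 1) hkn
    have hqueue : (N.enqueue (T (k + 1)) (a (k + 1)) (s.journey (b k)) f).queue <+:
        (F (d + 1)).queue := by
      rw [hS.eq (d + 1), hR, enqueueAll_append, enqueueAll_cons]
      exact prefix_enqueueAll_queue _ _
    unfold enqueue at hqueue
    rw [if_neg (by omega)] at hqueue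
    obtain ⟨l, hl⟩ := hqueue
    rw [List.append_assoc, List.singleton_append] at hl
    refine ⟨f.queue, _, l, hl.symm, rfl, le_rfl, by simp, fun _ => rfl, hab,
      by dsimp only; omega, hnew, ?_⟩
    intro j hj hjk x
    rw [QueueElem.journey, QueueElem.journey, journeyTransfers_append_pair, List.mem_append,
      List.mem_singleton]
    rcases (Nat.lt_succ_iff.1 hjk).lt_or_eq with hjk | rfl
    · exact Or.inl (hjt j hj hjk (b k))
    · exact Or.inr (by rw [hst])

/-- If an optimal route passes the event `(T m, i)`, leaves the cell `C` for the first time after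
that at `(T q, j)`, and its transfers in between are not discarded, then the Event-TB search from
`(T m, i)` finds these transfers. -/
theorem IsOptimalRoute.exists_mem_found (h𝔗 : ∀ t ∈ 𝔗, N.IsCandidate t)
    (hT : N.IsOptimalRoute O ps pt A n T a b pre) {m i q j : ℕ} (hmq : m ≤ q) (hq : q ≤ n)
    (hi : a m ≤ i) (hib : i < b m) (hj : a q ≤ j) (hmj : q = m → i ≤ j) (hjb : j < b q)
    (hrank : ∀ k, m ≤ k → k < q → ℓ ≤ rank ((T k, b k), (T (k + 1), a (k + 1))))
    (hobe : ∀ k, m ≤ k → k ≤ q → ∀ x, a k ≤ x → (k = m → i ≤ x) → x < b k → (k = q → x < j) →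
      ¬ N.IsOBE C (T k, x)) (hjC : N.IsOBE C (T q, j)) :
    ∃ d, ∃ y ∈ (N.eventState O C ℓ rank (T m, i) d).found, ∀ k, m ≤ k → k < q →
      ((T k, b k), (T (k + 1), a (k + 1))) ∈ journeyTransfers y.2 := by
  obtain ⟨d, rfl⟩ := Nat.exists_eq_add_of_le hmq
  obtain ⟨l₁, s, l₂, hqueue, hst, has, hsi, hsa, hsb, hbl, hl₁, hjt⟩ :=
    hT.exists_eventFrontier h𝔗 (C := C) (rank := rank) (hmq.trans hq) hi hib d hq hrank
      fun k h1 h2 x h3 h4 h5 => hobe k h1 h2.le x h3 h4 h5 (by omega)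
  have hsj : s.entry ≤ j := by
    rcases Nat.eq_zero_or_pos d with hd | hd
    · exact hsi hd ▸ hmj (by omega)
    · exact hsa (by omega) ▸ hj
  have hfirst : N.firstOBE C s = some j := by
    refine firstOBE_eq_some hsj (by omega) (hst ▸ hjC) fun x hx hxj => hst ▸ hobe (m + d) hmq
      le_rfl x (has.trans hx) (fun hd => ?_) (by omega) (fun _ => hxj)
    exact hsi (by omega) ▸ hx
  -- The border event cannot have been collected before: the element it was collected from
  -- could continue along the rest of the route.
  have hnew : ¬ ∃ y ∈ l₁.foldl (N.collectOBE C) (N.eventState O C ℓ rank (T m, i) d).found,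
      y.1 = (s.trip, j) := by
    rintro ⟨y, hy, hyj⟩
    have hb : ∀ s' : QueueElem Trip, y.1.1 = s'.trip → s'.entry ≤ y.1.2 →
        N.Boards pt A (n - (m + d)) s'.trip s'.entry := by
      intro s' h1 h2
      rw [hyj] at h1 h2
      rw [← h1, hst]
      exact ⟨b (m + d), h2.trans_lt hjb, hT.exit_le _ hq, hT.reaches _ hq⟩
    rcases mem_foldl_collectOBE hy with hy | ⟨s', hs', h1, h2⟩
    · obtain ⟨k, hk, s', hs', h1, h2⟩ := exists_of_mem_found hy
      exact hT.not_boards_of_mem_eventFrontier h𝔗 (hmq.trans hq) hi hib (by omega) hs'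
        (hb s' h1 h2)
    · exact hl₁ s' hs' (hb s' h1 h2)
  refine ⟨d + 1, ((s.trip, j), s.journey j), ?_, fun k h1 h2 => hjt k h1 h2 j⟩
  rw [eventState_succ_found, hqueue, List.foldl_append, List.foldl_cons]
  refine subset_foldl_collectOBE _ _ _ ?_
  rw [collectOBE, hfirst]
  dsimp only
  rw [if_neg hnew]
  simp

end

end Network

end TREX

namespace TREX

/-! ### Cells and lowest common levels -/

namespace NestedBipartition

variable {V : Type*} {K : ℕ} (B : NestedBipartition V K)

theorem lcl_spec (u v : V) : B.lcl u v ≤ K ∧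
    ∃ i, i < 2 ^ (K - B.lcl u v) ∧ u ∈ B.cell (B.lcl u v) i ∧ v ∈ B.cell (B.lcl u v) i := by
  refine Nat.sInf_mem (s := {ℓ | ℓ ≤ K ∧ ∃ i, i < 2 ^ (K - ℓ) ∧ u ∈ B.cell ℓ i ∧ v ∈ B.cell ℓ i})
    ⟨K, le_rfl, ?_⟩
  obtain ⟨i, hi, hu⟩ := B.cover K le_rfl u
  obtain ⟨j, hj, hv⟩ := B.cover K le_rfl v
  rw [Nat.sub_self, pow_zero, Nat.lt_one_iff] at hi hj
  subst hi hj
  exact ⟨0, by simp, hu, hv⟩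

theorem notMem_cell_of_lt_lcl {u v : V} {ℓ i : ℕ} (h : ℓ < B.lcl u v) (hi : i < 2 ^ (K - ℓ))
    (hu : u ∈ B.cell ℓ i) : v ∉ B.cell ℓ i := fun hv =>
  Nat.notMem_of_lt_sInf h ⟨h.le.trans (B.lcl_spec u v).1, i, hi, hu, hv⟩

/-- Vertices that share a cell share a cell on each higher level. -/
theorem exists_cell_of_le {u v : V} {ℓ ℓ' i : ℕ} (h : ℓ ≤ ℓ') (hK : ℓ' ≤ K)
    (hi : i < 2 ^ (K - ℓ)) (hu : u ∈ B.cell ℓ i) (hv : v ∈ B.cell ℓ i) :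
    ∃ j, j < 2 ^ (K - ℓ') ∧ u ∈ B.cell ℓ' j ∧ v ∈ B.cell ℓ' j := by
  induction ℓ', h using Nat.le_induction with
  | base => exact ⟨i, hi, hu, hv⟩
  | succ ℓ' _ ih =>
    obtain ⟨j, hj, hu, hv⟩ := ih (by omega)
    have hpow : 2 ^ (K - ℓ') = 2 * 2 ^ (K - (ℓ' + 1)) := by
      rw [← pow_succ']
      congr 1
      omega
    have hsplit := B.split ℓ' (by omega) (j / 2) (by omega)
    have hsub : B.cell ℓ' j ⊆ B.cell (ℓ' + 1) (j / 2) := by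
      rw [← hsplit]
      rcases Nat.mod_two_eq_zero_or_one j with h | h
      · rw [show 2 * (j / 2) = j by omega]
        exact Set.subset_union_left
      · rw [show 2 * (j / 2) + 1 = j by omega]
        exact Set.subset_union_right
    exact ⟨j / 2, by omega, hsub hu, hsub hv⟩

theorem lt_lcl_of_notMem_cell {u v : V} {ℓ i : ℕ} (hK : ℓ ≤ K) (hi : i < 2 ^ (K - ℓ))
    (hu : u ∈ B.cell ℓ i) (hv : v ∉ B.cell ℓ i) : ℓ < B.lcl u v := by
  by_contra h
  obtain ⟨-, j, hj, hu', hv'⟩ := B.lcl_spec u v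
  obtain ⟨j', hj', hu'', hv''⟩ := B.exists_cell_of_le (not_lt.1 h) hK hj hu' hv'
  rcases eq_or_ne j' i with rfl | hne
  · exact hv hv''
  · exact Set.disjoint_left.1 (B.disjoint ℓ hK j' i hj' hi hne) hu'' hu

end NestedBipartition

namespace Network

variable {Stop Trip Line : Type*} {N : Network Stop Trip Line} {𝔗 : Set (Transfer Trip)}
  {O : N.ScanOrder 𝔗}

theorem vertex_eq_of_foot {p q : Stop} (h : N.foot p q) : N.vertex p = N.vertex q :=
  Quot.sound h

theorem exists_last_not {p : ℕ → Prop} {a b : ℕ} (hb : p b) (h : ¬ ∀ x, a ≤ x → x ≤ b → p x) :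
    ∃ i, a ≤ i ∧ i < b ∧ ¬ p i ∧ ∀ x, i < x → x ≤ b → p x := by
  classical
  push Not at h
  obtain ⟨y, hay, hyb, hy⟩ := h
  have hspec := Nat.findGreatest_spec (P := fun x => ¬ p x) hyb hy
  refine ⟨Nat.findGreatest (fun x => ¬ p x) b, hay.trans (Nat.le_findGreatest hyb hy),
    (Nat.findGreatest_le b).lt_of_ne fun h => ?_, hspec,
    fun x hx hxb => not_not.1 (Nat.findGreatest_is_greatest hx hxb)⟩
  rw [h] at hspec
  exact hspec hb

theorem exists_first_not {p : ℕ → Prop} {a b : ℕ} (ha : p a) (h : ¬ ∀ x, a ≤ x → x ≤ b → p x) :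
    ∃ j, a ≤ j ∧ j < b ∧ ¬ p (j + 1) ∧ ∀ x, a ≤ x → x ≤ j → p x := by
  classical
  push Not at h
  have hspec := Nat.find_spec h
  have hmin := fun x => Nat.find_min h (m := x)
  generalize Nat.find h = y at hspec hmin
  obtain ⟨hay, hyb, hy⟩ := hspec
  have hne : a ≠ y := fun h => hy (h ▸ ha)
  refine ⟨y - 1, by omega, by omega, by rwa [Nat.sub_add_cancel (by omega)], fun x hx hxy => ?_⟩
  by_contra hpx
  exact hmin x (by omega) ⟨hx, by omega, hpx⟩

namespace IsOptimalRoute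

variable {ps pt : Stop} {A : ℤ} {n : ℕ} {T : ℕ → Trip} {a b : ℕ → ℕ}
  {pre : ℕ → List (StopEvent Trip)}

theorem vertex_succ (h𝔗 : ∀ t ∈ 𝔗, N.IsCandidate t)
    (hT : N.IsOptimalRoute O ps pt A n T a b pre) {k : ℕ} (hk : k < n) :
    N.vertex (N.stopOf (T k, b k)) = N.vertex (N.stopOf (T (k + 1), a (k + 1))) := by
  obtain ⟨post, hpost⟩ := hT.transfers k hk
  exact vertex_eq_of_foot (h𝔗 _ ((O.mem_transfers _ _).1 (by simp [hpost]))).1.2.2.1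

/-- A route that is in a cell without the source has entered the cell before. -/
theorem exists_entering (h𝔗 : ∀ t ∈ 𝔗, N.IsCandidate t)
    (hT : N.IsOptimalRoute O ps pt A n T a b pre) {C : Set N.Vertex} (hps : N.vertex ps ∉ C)
    {c : ℕ} (hc : c ≤ n) (hcC : N.vertex (N.stopOf (T c, b c)) ∈ C) :
    ∃ m ≤ c, ∃ i, a m ≤ i ∧ i < b m ∧ N.vertex (N.stopOf (T m, i)) ∉ C ∧
      ∀ k, m ≤ k → k ≤ c → ∀ x, a k ≤ x → x ≤ b k → (k = m → i < x) →
        N.vertex (N.stopOf (T k, x)) ∈ C := by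
  by_cases hall : ∀ x, a c ≤ x → x ≤ b c → N.vertex (N.stopOf (T c, x)) ∈ C
  · have haC := hall (a c) le_rfl (hT.entry_lt c hc).le
    cases c with
    | zero => exact absurd (vertex_eq_of_foot hT.start ▸ haC) hps
    | succ c =>
      obtain ⟨m, hm, i, hi, hib, hiC, hin⟩ :=
        exists_entering h𝔗 hT hps (c := c) (by omega) (hT.vertex_succ h𝔗 hc ▸ haC)
      refine ⟨m, by omega, i, hi, hib, hiC, fun k h1 h2 x h3 h4 h5 => ?_⟩
      rcases Nat.lt_or_ge c k with hk | hk
      · obtain rfl : k = c + 1 := by omega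
        exact hall x h3 h4
      · exact hin k h1 hk x h3 h4 h5
  · obtain ⟨i, hi, hib, hiC, hin⟩ :=
      exists_last_not (p := fun x => N.vertex (N.stopOf (T c, x)) ∈ C) hcC hall
    refine ⟨c, le_rfl, i, hi, hib, hiC, fun k h1 h2 x h3 h4 h5 => ?_⟩
    obtain rfl : k = c := by omega
    exact hin x (h5 rfl) h4

/-- A route that is in a cell without the target leaves the cell later. -/
theorem exists_leaving (h𝔗 : ∀ t ∈ 𝔗, N.IsCandidate t)
    (hT : N.IsOptimalRoute O ps pt A n T a b pre) {C : Set N.Vertex} (hpt : N.vertex pt ∉ C)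
    {c : ℕ} (hc : c ≤ n) (hcC : N.vertex (N.stopOf (T c, a c)) ∈ C) :
    ∃ q, c ≤ q ∧ q ≤ n ∧ ∃ j, a q ≤ j ∧ j < b q ∧ N.vertex (N.stopOf (T q, j + 1)) ∉ C ∧
      ∀ k, c ≤ k → k ≤ q → ∀ x, a k ≤ x → x ≤ b k → (k = q → x ≤ j) →
        N.vertex (N.stopOf (T k, x)) ∈ C := by
  by_cases hall : ∀ x, a c ≤ x → x ≤ b c → N.vertex (N.stopOf (T c, x)) ∈ C
  · have hbC := hall (b c) (hT.entry_lt c hc).le le_rfl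
    rcases hc.lt_or_eq with hcn | rfl
    · obtain ⟨q, hcq, hq, j, hj, hjb, hjC, hin⟩ :=
        exists_leaving h𝔗 hT hpt (c := c + 1) hcn (hT.vertex_succ h𝔗 hcn ▸ hbC)
      refine ⟨q, by omega, hq, j, hj, hjb, hjC, fun k h1 h2 x h3 h4 h5 => ?_⟩
      rcases h1.lt_or_eq with hk | rfl
      · exact hin k hk h2 x h3 h4 h5
      · exact hall x h3 h4
    · exact absurd (vertex_eq_of_foot hT.finish ▸ hbC) hpt
  · obtain ⟨j, hj, hjb, hjC, hin⟩ :=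
      exists_first_not (p := fun x => N.vertex (N.stopOf (T c, x)) ∈ C) hcC hall
    refine ⟨c, le_rfl, hc, j, hj, hjb, hjC, fun k h1 h2 x h3 h4 h5 => ?_⟩
    obtain rfl : k = c := by omega
    exact hin x h3 (h5 rfl)
termination_by n - c

/-- Each transfer of an optimal route that lies in a cell with neither source nor target is found by
the customization of this cell, if the transfers of the route inside of the cell are not
discarded. -/
theorem isUnpacked (h𝔗 : ∀ t ∈ 𝔗, N.IsCandidate t)
    (hT : N.IsOptimalRoute O ps pt A n T a b pre) {K : ℕ} (B : NestedBipartition N.Vertex K)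
    {ℓ z : ℕ} (hz : z < 2 ^ (K - ℓ)) (rank : Transfer Trip → ℕ)
    (hps : N.vertex ps ∉ B.cell ℓ z) (hpt : N.vertex pt ∉ B.cell ℓ z)
    (hrank : ∀ k < n, N.vertex (N.stopOf (T k, b k)) ∈ B.cell ℓ z →
      ℓ ≤ rank ((T k, b k), (T (k + 1), a (k + 1))))
    {c : ℕ} (hc : c < n) (hcC : N.vertex (N.stopOf (T c, b c)) ∈ B.cell ℓ z) :
    N.IsUnpacked O B ℓ rank ((T c, b c), (T (c + 1), a (c + 1))) := by
  obtain ⟨m, hmc, i, hi, hib, hiC, hin⟩ := hT.exists_entering h𝔗 hps hc.le hcC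
  obtain ⟨q, hcq, hq, j, hj, hjb, hjC, hout⟩ :=
    hT.exists_leaving h𝔗 hpt hc (hT.vertex_succ h𝔗 hc ▸ hcC)
  have hlen := hT.exit_le
  have hpos := hT.entry_pos
  have hab := hT.entry_lt
  have hC : ∀ k, m ≤ k → k ≤ q → ∀ x, a k ≤ x → x ≤ b k → (k = m → i < x) → (k = q → x ≤ j) →
      N.vertex (N.stopOf (T k, x)) ∈ B.cell ℓ z := fun k h1 h2 x h3 h4 h5 h6 => by
    rcases Nat.lt_or_ge c k with hk | hk
    · exact hout k hk h2 x h3 h4 h6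
    · exact hin k h1 hk x h3 h4 h5
  obtain ⟨d, y, hy, hyt⟩ := hT.exists_mem_found h𝔗 (C := B.cell ℓ z) (ℓ := ℓ) (rank := rank)
    (m := m) (i := i) (q := q) (j := j) (by omega) hq hi hib hj (by omega) hjb
    (fun k h1 h2 => hrank k (by omega) (hC k h1 h2.le (b k) (hab k (by omega)).le le_rfl
      (fun h => h ▸ hib) (by omega)))
    (fun k h1 h2 x h3 h4 h5 h6 h7 => h7.2.2.2 (hC k h1 h2 (x + 1) (by omega) h5
      (fun h => Nat.lt_succ_of_le (h4 h)) h6))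
    ⟨(hpos q hq).trans hj, hjb.trans_le (hlen q hq),
      hC q (by omega) le_rfl j hj hjb.le (by omega) (fun _ => le_rfl), hjC⟩
  refine ⟨z, hz, (T m, i), ⟨(hpos m (by omega)).trans hi, hib.trans_le (hlen m (by omega)), hiC,
    hC m le_rfl (by omega) (i + 1) (by omega) hib (fun _ => Nat.lt_succ_self i) (by omega)⟩,
    d, y, hy, hyt c hmc hcq⟩

end IsOptimalRoute

/-! ### Ranks -/

theorem rankAfter_le {K : ℕ} (B : NestedBipartition N.Vertex K) (ℓ : ℕ) (t : Transfer Trip) :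
    N.rankAfter O B ℓ t ≤ ℓ := by
  induction ℓ with
  | zero => exact le_rfl
  | succ ℓ ih =>
    rw [rankAfter]
    split_ifs <;> omega

theorem rankAfter_mono {K : ℕ} (B : NestedBipartition N.Vertex K) {ℓ ℓ' : ℕ} (h : ℓ ≤ ℓ')
    (t : Transfer Trip) : N.rankAfter O B ℓ t ≤ N.rankAfter O B ℓ' t := by
  induction ℓ', h using Nat.le_induction with
  | base => exact le_rfl
  | succ ℓ' _ ih =>
    refine ih.trans ?_
    have := rankAfter_le (O := O) B ℓ' t
    rw [rankAfter]
    split_ifs <;> omega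

theorem IsOptimalRoute.le_rankAfter {ps pt : Stop} {A : ℤ} {n : ℕ} {T : ℕ → Trip} {a b : ℕ → ℕ}
    {pre : ℕ → List (StopEvent Trip)} (h𝔗 : ∀ t ∈ 𝔗, N.IsCandidate t)
    (hT : N.IsOptimalRoute O ps pt A n T a b pre) {K : ℕ} (B : NestedBipartition N.Vertex K)
    {ℓ k : ℕ} (hk : k < n) (hs : ℓ ≤ N.lcl B (N.stopOf (T k, b k)) ps)
    (ht : ℓ ≤ N.lcl B (N.stopOf (T k, b k)) pt) :
    ℓ ≤ N.rankAfter O B ℓ ((T k, b k), (T (k + 1), a (k + 1))) := by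
  induction ℓ generalizing k with
  | zero => exact Nat.zero_le _
  | succ ℓ ih =>
    have hK : ℓ ≤ K := (Nat.lt_of_succ_le hs).le.trans (B.lcl_spec _ _).1
    obtain ⟨z, hz, hkz⟩ := B.cover ℓ hK (N.vertex (N.stopOf (T k, b k)))
    have hps := B.notMem_cell_of_lt_lcl (Nat.lt_of_succ_le hs) hz hkz
    have hpt := B.notMem_cell_of_lt_lcl (Nat.lt_of_succ_le ht) hz hkz
    rw [rankAfter, if_pos]
    refine hT.isUnpacked h𝔗 B hz _ hps hpt (fun c hc hcz => ih hc ?_ ?_) hk hkz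
    · exact (B.lt_lcl_of_notMem_cell hK hz hcz hps).le
    · exact (B.lt_lcl_of_notMem_cell hK hz hcz hpt).le

end Network

end TREX

theorem theorem2 {Stop Trip Line : Type*} [Finite Stop] [Finite Trip] [Finite Line]
    (N : TREX.Network Stop Trip Line)
    (𝔗 : Set (TREX.Transfer Trip)) (h𝔗 : N.IsPrecomputed 𝔗) (O : N.ScanOrder 𝔗)
    (K : ℕ) (hK : 0 < K) (B : TREX.NestedBipartition N.Vertex K)
    (ps pt : Stop) (τ : ℤ) (J : TREX.Label Trip) (hJ : N.TBReturns O ps pt τ J)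
    (hwalk : N.foot ps pt → J.arrival < τ + N.walk ps pt) :
    ∀ t ∈ TREX.journeyTransfers J.journey, N.PassesLCLTest O B ps pt t := by
  intro t ht
  obtain ⟨m, -, hJ⟩ := hJ
  obtain ⟨n, T, a, b, pre, hT, hjt⟩ := TREX.Network.exists_isOptimalRoute h𝔗 hJ hwalk
  obtain ⟨k, hk, rfl⟩ := hjt t ht
  refine (hT.le_rankAfter (fun t ht => h𝔗.isCandidate ht) B hk (min_le_left _ _)
    (min_le_right _ _)).trans (TREX.Network.rankAfter_mono B ?_ _)
  exact (min_le_left _ _).trans (B.lcl_spec _ _).1
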